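/- Let $\mathbb{G}$ be a homogeneous Carnot group on $\mathbb{R}^n$: that is, $\mathbb{R}^n$ with a smooth group law $\circ$ whose unit is the origin, with coordinates grouped in layers $x=(x^{(1)},\dots,x^{(s)})$ such that all dilations $\delta_R(x)=(Rx^{(1)},\dots,R^s x^{(s)})$, $R>0$, are group automorphisms, and such that the left-invariant vector fields $X_1,\dots,X_m$ that agree at the origin with the coordinate fields of the first layer $x^{(1)}\in\mathbb{R}^m$ generate the Lie algebra of $\mathbb{G}$. (Every Carnot group is isomorphic to one of these.) Let $\nabla_0 u=(X_1u,\dots,X_mu)$ be the horizontal gradient, $\mathrm{div}_0$ the horizontal divergence ($\mathrm{div}_0 Y=\sum_j X_j y^j$ for $Y=\sum_j y^jX_j$), $|\cdot|$ the Euclidean norm on the first layer for which the $X_j$ are orthonormal, and $\mathrm{d}x$ the Lebesgue measure. Let $r$ be a symmetric homogeneous norm on $\mathbb{G}$: a continuous function with $r(0)=0$, $r(x)>0$ for $x\ne0$, $r(\delta_R(x))=Rr(x)$ for $R>0$ and $r(x^{-1})=r(x)$. A function $u$ is Lipschitz on a set $S$ if $u(x)-u(y)\le C\,r(x^{-1}\circ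 y)$ for all $x,y\in S$ and some constant $C$; $\mathrm{Lip}_{\mathrm{loc}}(\mathbb{G})$ is the set of functions that are Lipschitz in a neighbourhood of each point, and $\mathrm{Lip}_c(\mathbb{G})$ the set of Lipschitz functions on $\mathbb{G}$ with compact support. For such functions $\nabla_0$ is understood in the weak sense. Fix $\mu,\chi,\omega\in\mathbb{R}$ with $$0\le\chi\le1,\qquad \mu<2-\chi,\qquad \omega>1-\chi.$$ Let $b\in C^0(\mathbb{G})$ with $b>0$, $f\in C^0(\mathbb{R})$, and $l\in C^0([0,+\infty))$ with $l(t)>0$ for $t>0$, and suppose that for some constant $C>0$ $$b\ge C(1+r)^{-\mu}\ \text{ on }\mathbb{G},\qquad f(t)\ge Ct^{\omega}\ \text{ for $t$ large enough},\qquad l(t)\ge C\frac{t^{\chi}}{1+t}\ \text{ for all } t>0 .$$ A function $u\in\mathrm{Lip}_{\mathrm{loc}}(\mathbb{G})$ is called a weak solution of $$\mathrm{div}_0\left(\frac{\nabla_0u}{\sqrt{1+|\nabla_0u|^2}}\right)\ge b(x)f(u)\,l(|\nabla_0u|)\quad\text{on }\mathbb{G}\qquad(\ast)$$ if for every $\phi\in\mathrm{Lip}_c(\mathbb{G})$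 with $\phi\ge0$ $$\int_{\mathbb{G}}\frac{\langle\nabla_0u,\nabla_0\phi\rangle}{\sqrt{1+|\nabla_0u|^2}}\,\mathrm{d}x\le-\int_{\mathbb{G}}b(x)f(u)\,l(|\nabla_0u|)\,\phi\,\mathrm{d}x ,$$ and a weak solution of $(\ast)$ with the equality sign if equality holds here for every such $\phi$. Write $u^*=\sup_{\mathbb{G}}u$ and $u_*=\inf_{\mathbb{G}}u$. Then: 1. Every weak solution $u\in\mathrm{Lip}_{\mathrm{loc}}(\mathbb{G})$ of $(\ast)$ satisfies $u^*<+\infty$, and $f(u^*)\le0$ unless $u$ is constant. 2. If moreover there is a constant $C'>0$ such that $tf(t)\ge C'|t|^{\omega+1}$ for $|t|$ large enough, then every weak solution $u\in\mathrm{Lip}_{\mathrm{loc}}(\mathbb{G})$ of $(\ast)$ with the equality sign is bounded and, if $u$ is not constant, satisfies $f(u^*)\le0\le f(u_*)$. -/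

import Mathlib

open MeasureTheory Set

section

open scoped ContDiff

/-- A homogeneous Lie group on `ℝⁿ`: a smooth group law with unit the origin, for which the
dilations `x ↦ (R ^ deg 1 * x₁, …, R ^ deg n * xₙ)`, `R > 0`, are group automorphisms. The coordinate
`xᵢ` belongs to the layer number `deg i`, and coordinates are listed layer after layer. -/
structure HomogeneousLieGroup (n : ℕ) where
  deg : Fin n → ℕ
  deg_pos : ∀ i, 1 ≤ deg i
  deg_mono : Monotone deg
  mul : (Fin n → ℝ) → (Fin n → ℝ) → (Fin n → ℝ)
  inv : (Fin n → ℝ) → (Fin n → ℝ)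
  mul_assoc : ∀ x y z, mul (mul x y) z = mul x (mul y z)
  zero_mul : ∀ x, mul 0 x = x
  mul_zero : ∀ x, mul x 0 = x
  inv_mul_cancel : ∀ x, mul (inv x) x = 0
  contDiff_mul : ContDiff ℝ ∞ (fun p : (Fin n → ℝ) × (Fin n → ℝ) => mul p.1 p.2)
  contDiff_inv : ContDiff ℝ ∞ inv
  dilation_mul : ∀ R : ℝ, 0 < R → ∀ x y,
    (fun i => R ^ deg i * mul x y i) = mul (fun i => R ^ deg i * x i) (fun i => R ^ deg i * y i)

namespace HomogeneousLieGroup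

variable {n : ℕ} (G : HomogeneousLieGroup n)

/-- The dilation `δ_R`. -/
def dilation (R : ℝ) (x : Fin n → ℝ) : Fin n → ℝ := fun i => R ^ G.deg i * x i

/-- The left-invariant vector field `X_j` that equals `∂_j` at the origin. -/
noncomputable def X (j : Fin n) : (Fin n → ℝ) → (Fin n → ℝ) :=
  fun x => fderiv ℝ (fun y => G.mul x y) 0 (Pi.single j 1)

/-- Indices of the coordinates of the first layer. -/
abbrev Hor : Type := {j : Fin n // G.deg j = 1}

/-- The vector fields `X_j` of the first layer and all their iterated Lie brackets. -/
inductive IsIteratedBracket : ((Fin n → ℝ) → (Fin n → ℝ)) → Prop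
  | base (j : G.Hor) : IsIteratedBracket (G.X j)
  | bracket {V W : (Fin n → ℝ) → (Fin n → ℝ)} : IsIteratedBracket V → IsIteratedBracket W →
      IsIteratedBracket (VectorField.lieBracket ℝ V W)

end HomogeneousLieGroup

/-- A homogeneous Carnot group on `ℝⁿ`: a homogeneous Lie group whose Lie algebra is generated by
the first layer. -/
structure HomogeneousCarnotGroup (n : ℕ) extends HomogeneousLieGroup n where
  generated : ∀ x : Fin n → ℝ,
    Submodule.span ℝ {v | ∃ V, toHomogeneousLieGroup.IsIteratedBracket V ∧ v = V x} = ⊤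

namespace HomogeneousCarnotGroup

variable {n : ℕ} (G : HomogeneousCarnotGroup n)

/-- Symmetric homogeneous norms. -/
structure IsHomogeneousNorm (r : (Fin n → ℝ) → ℝ) : Prop where
  continuous : Continuous r
  zero : r 0 = 0
  pos : ∀ x, x ≠ 0 → 0 < r x
  dilation : ∀ R : ℝ, 0 < R → ∀ x, r (G.dilation R x) = R * r x
  symm : ∀ x, r (G.inv x) = r x

/-- `u` is Lipschitz on `S` with respect to `r`. -/
def IsLipOn (r u : (Fin n → ℝ) → ℝ) (S : Set (Fin n → ℝ)) : Prop :=
  ∃ C : ℝ, 0 < C ∧ ∀ x ∈ S, ∀ y ∈ S, u x - u y ≤ C * r (G.mul (G.inv x) y)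

/-- `u ∈ Lip_loc(G)`. -/
def IsLipLoc (r u : (Fin n → ℝ) → ℝ) : Prop :=
  ∀ x, ∃ S ∈ nhds x, G.IsLipOn r u S

/-- `φ ∈ Lip_c(G)`. -/
def IsLipC (r φ : (Fin n → ℝ) → ℝ) : Prop :=
  G.IsLipOn r φ univ ∧ HasCompactSupport φ

/-- `U` is the weak horizontal gradient of `u`: its component along `X_j` is the weak derivative
`X_j u` (the formal adjoint of `X_j` with respect to Lebesgue measure is `-X_j`). Since the `X_j`
are declared orthonormal, a horizontal field is written as a Euclidean vector. -/
def IsWeakGradient (u : (Fin n → ℝ) → ℝ) (U : (Fin n → ℝ) → EuclideanSpace ℝ G.Hor) : Prop :=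
  LocallyIntegrable U volume ∧
  ∀ (j : G.Hor) (φ : (Fin n → ℝ) → ℝ), ContDiff ℝ ∞ φ → HasCompactSupport φ →
    ∫ x, u x * fderiv ℝ φ x (G.X j x) = - ∫ x, U x j * φ x

/-- `u ∈ Lip_loc(G)` is a weak solution of
`div₀ (∇₀u / √(1 + |∇₀u|²)) ≥ b(x) f(u) l(|∇₀u|)` on `G`. -/
def IsMeanCurvatureSubsolution (r b : (Fin n → ℝ) → ℝ) (f l : ℝ → ℝ)
    (u : (Fin n → ℝ) → ℝ) : Prop :=
  G.IsLipLoc r u ∧ ∃ U, G.IsWeakGradient u U ∧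
    ∀ φ Φ, G.IsLipC r φ → (∀ x, 0 ≤ φ x) → G.IsWeakGradient φ Φ →
      ∫ x, inner ℝ (U x) (Φ x) / √(1 + ‖U x‖ ^ 2) ≤
        - ∫ x, b x * f (u x) * l ‖U x‖ * φ x

/-- `u ∈ Lip_loc(G)` is a weak solution of
`div₀ (∇₀u / √(1 + |∇₀u|²)) = b(x) f(u) l(|∇₀u|)` on `G`. -/
def IsMeanCurvatureSolution (r b : (Fin n → ℝ) → ℝ) (f l : ℝ → ℝ)
    (u : (Fin n → ℝ) → ℝ) : Prop :=
  G.IsLipLoc r u ∧ ∃ U, G.IsWeakGradient u U ∧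
    ∀ φ Φ, G.IsLipC r φ → (∀ x, 0 ≤ φ x) → G.IsWeakGradient φ Φ →
      ∫ x, inner ℝ (U x) (Φ x) / √(1 + ‖U x‖ ^ 2) =
        - ∫ x, b x * f (u x) * l ‖U x‖ * φ x

end HomogeneousCarnotGroup

end

/-! ### Group identities, invariance of Lebesgue measure, left-invariant fields. -/

section

open scoped ContDiff Topology
open Filter

namespace HomogeneousLieGroup

variable {n : ℕ} (G : HomogeneousLieGroup n)

/-! Fix a level γ, put v = (u - γ)₊, t = |∇₀u|, q = √(1 + t²), and let s be a cut-off at scale R.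
Testing the inequality with v² s^(m+1) produces a gradient term 2 v t² s^(m+1)/q, a source term, and
a cut-off error of order v² s^m t/(qR). Suppose f(u) ≥ c (1 + v)^θ with θ > 1 - χ wherever u > γ.
Then the source is at least a constant times R^(-μ) (1 + v)^θ t^χ v² s^(m+1)/q. If the error exceeds
both the source and one copy of the gradient term, t is squeezed between two bounds; eliminating it
bounds (1 + v)^(θ-1+χ) s^(2-χ) R^(2-χ-μ) by a constant. The exponents of 1 + v and R are positive by
hypothesis, so a high power of this estimate makes the error at most C'/R^N, for any prescribed N
once m is large (`exists_absorption_exponent`). No a priori bound on u is needed. Since the support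
of s has polynomial volume, a suitable N gives an energy v t²/q of at most C'/R on the ball of
radius R (`exists_energy_bound`).

Letting R → ∞, v ∇₀u = 0 almost everywhere, so v² has zero weak horizontal gradient and is constant
by bracket generation (`eq_of_weak_derivative_eq_zero`). Hence u ≤ γ or u is constant
(`le_or_const`). A large γ bounds u from above. If f(u*) > 0, a γ slightly below u* is also
admissible, because v is then bounded on {u > γ} and f(u) ≥ f(u*)/2 there; this forces u to be
constant. For equality, the same argument applies to -u.

The calculus behind the test function rests on difference quotients along right translations, which
preserve Lebesgue measure. They converge weakly to the weak gradient, which gives its local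
boundedness and the chain rule. -/

lemma mul_inv_cancel (x : Fin n → ℝ) : G.mul x (G.inv x) = 0 := by
  have h1 : G.mul (G.inv (G.inv x)) (G.mul (G.mul (G.inv x) x) (G.inv x)) = 0 := by
    rw [G.inv_mul_cancel, G.zero_mul, G.inv_mul_cancel]
  rwa [G.mul_assoc, ← G.mul_assoc (G.inv (G.inv x)), G.inv_mul_cancel, G.zero_mul] at h1

lemma inv_mul_cancel_left (x y : Fin n → ℝ) : G.mul (G.inv x) (G.mul x y) = y := by
  rw [← G.mul_assoc, G.inv_mul_cancel, G.zero_mul]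

lemma mul_inv_cancel_left (x y : Fin n → ℝ) : G.mul x (G.mul (G.inv x) y) = y := by
  rw [← G.mul_assoc, G.mul_inv_cancel, G.zero_mul]

lemma mul_inv_cancel_right (x y : Fin n → ℝ) : G.mul (G.mul x y) (G.inv y) = x := by
  rw [G.mul_assoc, G.mul_inv_cancel, G.mul_zero]

lemma inv_mul_cancel_right (x y : Fin n → ℝ) : G.mul (G.mul x (G.inv y)) y = x := by
  rw [G.mul_assoc, G.inv_mul_cancel, G.mul_zero]

lemma inv_zero : G.inv 0 = 0 := by
  simpa [G.mul_zero] using G.inv_mul_cancel 0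

lemma inv_mul_rev (x y : Fin n → ℝ) : G.inv (G.mul x y) = G.mul (G.inv y) (G.inv x) := by
  have h : G.mul (G.mul (G.inv y) (G.inv x)) (G.mul x y) = 0 := by
    rw [G.mul_assoc, G.inv_mul_cancel_left, G.inv_mul_cancel]
  calc G.inv (G.mul x y)
      = G.mul (G.mul (G.mul (G.inv y) (G.inv x)) (G.mul x y)) (G.inv (G.mul x y)) := by
        rw [h, G.zero_mul]
    _ = _ := G.mul_inv_cancel_right _ _

lemma inv_inv (x : Fin n → ℝ) : G.inv (G.inv x) = x := by
  have h := G.inv_mul_cancel_left (G.inv x) x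
  rwa [G.inv_mul_cancel, G.mul_zero] at h

lemma contDiff_mul_comp {E : Type*} [NormedAddCommGroup E] [NormedSpace ℝ E]
    {a b : E → (Fin n → ℝ)} (ha : ContDiff ℝ ∞ a) (hb : ContDiff ℝ ∞ b) :
    ContDiff ℝ ∞ fun p => G.mul (a p) (b p) :=
  G.contDiff_mul.comp (ha.prodMk hb)

lemma continuous_mul_comp {E : Type*} [TopologicalSpace E]
    {a b : E → (Fin n → ℝ)} (ha : Continuous a) (hb : Continuous b) :
    Continuous fun p => G.mul (a p) (b p) :=
  G.contDiff_mul.continuous.comp (ha.prodMk hb)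

lemma dilation_mul' {R : ℝ} (hR : 0 < R) (x y : Fin n → ℝ) :
    G.dilation R (G.mul x y) = G.mul (G.dilation R x) (G.dilation R y) :=
  G.dilation_mul R hR x y

/-- The dilation as a continuous linear map. -/
noncomputable def dilationCLM (R : ℝ) : (Fin n → ℝ) →L[ℝ] (Fin n → ℝ) :=
  ContinuousLinearMap.pi fun i => (R ^ G.deg i) • ContinuousLinearMap.proj i

lemma dilationCLM_apply (R : ℝ) (x : Fin n → ℝ) : G.dilationCLM R x = G.dilation R x := by
  ext i; simp [dilationCLM, dilation]

lemma dilation_dilation (R S : ℝ) (x : Fin n → ℝ) :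
    G.dilation R (G.dilation S x) = G.dilation (R * S) x := by
  ext i; simp [dilation, mul_pow, _root_.mul_assoc]

lemma dilation_one (x : Fin n → ℝ) : G.dilation 1 x = x := by
  ext i; simp [dilation]

lemma dilation_zero_left (x : Fin n → ℝ) : G.dilation 0 x = 0 := by
  ext i
  have := G.deg_pos i
  simp [dilation, show G.deg i ≠ 0 by omega]

lemma continuous_dilation (x : Fin n → ℝ) : Continuous fun R => G.dilation R x := by
  unfold dilation; fun_prop

lemma dilation_single {j : Fin n} (hj : G.deg j = 1) (R t : ℝ) :
    G.dilation R (Pi.single j t) = Pi.single j (R * t) := by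
  ext i
  by_cases h : i = j
  · subst h; simp [dilation, hj]
  · simp [dilation, h]

lemma fderiv_mul_zero_zero (a b : Fin n → ℝ) :
    fderiv ℝ (fun p : (Fin n → ℝ) × (Fin n → ℝ) => G.mul p.1 p.2) (0, 0) (a, b) = a + b := by
  have hd := ((G.contDiff_mul.differentiable (by simp)) (0, 0)).hasFDerivAt
  have h1 := HasFDerivAt.comp (f := fun x : Fin n → ℝ => (x, (0 : Fin n → ℝ))) (0 : Fin n → ℝ) hd
    ((hasFDerivAt_id (𝕜 := ℝ) (0 : Fin n → ℝ)).prodMk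
      (hasFDerivAt_const (0 : Fin n → ℝ) (0 : Fin n → ℝ)))
  have h2 := HasFDerivAt.comp (f := fun x : Fin n → ℝ => ((0 : Fin n → ℝ), x)) (0 : Fin n → ℝ) hd
    ((hasFDerivAt_const (𝕜 := ℝ) (0 : Fin n → ℝ) (0 : Fin n → ℝ)).prodMk
      (hasFDerivAt_id (0 : Fin n → ℝ)))
  simp only [Function.comp_def] at h1 h2
  simp only [G.mul_zero, G.zero_mul] at h1 h2
  have e1 := DFunLike.congr_fun (h1.unique (hasFDerivAt_id 0)) a
  have e2 := DFunLike.congr_fun (h2.unique (hasFDerivAt_id 0)) b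
  simp at e1 e2
  rw [show (a, b) = (a, 0) + ((0 : Fin n → ℝ), b) by simp, map_add, e1, e2]

lemma hasFDerivAt_inv_zero :
    HasFDerivAt G.inv (-ContinuousLinearMap.id ℝ (Fin n → ℝ)) 0 := by
  have hi := ((G.contDiff_inv.differentiable (by simp)) 0).hasFDerivAt
  have hd := ((G.contDiff_mul.differentiable (by simp)) (0, 0)).hasFDerivAt
  have h1 := HasFDerivAt.comp (f := fun x : Fin n → ℝ => (G.inv x, x)) (0 : Fin n → ℝ)
    (g := fun p : (Fin n → ℝ) × (Fin n → ℝ) => G.mul p.1 p.2) (by simpa only [G.inv_zero] using hd)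
    (hi.prodMk (hasFDerivAt_id (𝕜 := ℝ) (0 : Fin n → ℝ)))
  simp only [Function.comp_def] at h1
  simp only [G.inv_mul_cancel] at h1
  suffices h : -ContinuousLinearMap.id ℝ (Fin n → ℝ) = fderiv ℝ G.inv 0 by rwa [h]
  ext1 a
  have e := DFunLike.congr_fun (h1.unique (hasFDerivAt_const 0 0)) a
  simp [G.fderiv_mul_zero_zero] at e
  simp only [neg_apply, ContinuousLinearMap.id_apply]
  exact (eq_neg_of_add_eq_zero_left e).symm

/-- The Jacobian determinant of the right translation by `p.2` at `p.1`. -/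
noncomputable def rightDet (p : (Fin n → ℝ) × (Fin n → ℝ)) : ℝ :=
  (fderiv ℝ (fun x => G.mul x p.2) p.1).det

lemma differentiable_mul_right (y : Fin n → ℝ) : Differentiable ℝ fun x => G.mul x y :=
  (G.contDiff_mul_comp contDiff_id contDiff_const).differentiable (by simp)

lemma differentiable_mul_left (x : Fin n → ℝ) : Differentiable ℝ fun y => G.mul x y :=
  (G.contDiff_mul_comp contDiff_const contDiff_id).differentiable (by simp)

lemma continuous_rightDet : Continuous G.rightDet := by
  have h : ContDiff ℝ ∞ fun p : (Fin n → ℝ) × (Fin n → ℝ) =>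
      fderiv ℝ (fun x => G.mul x p.2) p.1 := by
    refine ContDiff.fderiv (m := ∞) (n := ∞)
      (f := fun p : (Fin n → ℝ) × (Fin n → ℝ) => fun x => G.mul x p.2) ?_ contDiff_fst (by simp)
    exact G.contDiff_mul_comp contDiff_snd (contDiff_snd.comp contDiff_fst)
  exact ContinuousLinearMap.continuous_det.comp h.continuous

/-- Since δ_R is a linear automorphism, it intertwines the right translations by y and by δ_R y. The
chain rule gives det δ_R on both sides, and it cancels. -/
lemma rightDet_dilation {R : ℝ} (hR : 0 < R) (x y : Fin n → ℝ) :
    G.rightDet (G.dilation R x, G.dilation R y) = G.rightDet (x, y) := by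
  have h1 : HasFDerivAt (fun z => G.dilation R (G.mul z y))
      ((G.dilationCLM R).comp (fderiv ℝ (fun z => G.mul z y) x)) x := by
    have := (G.dilationCLM R).hasFDerivAt.comp x ((G.differentiable_mul_right y) x).hasFDerivAt
    refine this.congr_of_eventuallyEq (Eventually.of_forall fun z => ?_)
    simp [dilationCLM_apply]
  have h2 : HasFDerivAt (fun z => G.mul (G.dilation R z) (G.dilation R y))
      ((fderiv ℝ (fun z => G.mul z (G.dilation R y)) (G.dilation R x)).comp (G.dilationCLM R)) x := by
    have hc : HasFDerivAt (fun z => G.dilation R z) (G.dilationCLM R) x := by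
      refine (G.dilationCLM R).hasFDerivAt.congr_of_eventuallyEq (Eventually.of_forall fun z => ?_)
      simp [dilationCLM_apply]
    exact ((G.differentiable_mul_right (G.dilation R y)) (G.dilation R x)).hasFDerivAt.comp x hc
  have h3 := h1.unique (by simpa only [G.dilation_mul' hR] using h2)
  have h4 := congrArg ContinuousLinearMap.det h3
  have hdet : (G.dilationCLM R).det ≠ 0 := by
    have hinv : (G.dilationCLM R⁻¹).comp (G.dilationCLM R) = ContinuousLinearMap.id ℝ _ := by
      ext1 z
      simp [dilationCLM_apply, dilation_dilation, hR.ne', dilation_one]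
    intro h0
    have := congrArg ContinuousLinearMap.det hinv
    simp only [ContinuousLinearMap.det, ContinuousLinearMap.toLinearMap_comp, LinearMap.det_comp] at this h0
    simp [h0] at this
  simp only [ContinuousLinearMap.det, ContinuousLinearMap.toLinearMap_comp, LinearMap.det_comp] at h4 hdet
  unfold rightDet
  simp only [ContinuousLinearMap.det]
  rw [mul_comm] at h4
  exact (mul_right_cancel₀ hdet h4).symm

/-- Dilation invariance allows R → 0: the Jacobian equals its value at (0, 0), where the translation
is the identity. -/
lemma rightDet_eq_one (x y : Fin n → ℝ) : G.rightDet (x, y) = 1 := by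
  have h1 : Tendsto (fun R : ℝ => G.rightDet (G.dilation R x, G.dilation R y)) (𝓝[>] 0)
      (𝓝 (G.rightDet (G.dilation 0 x, G.dilation 0 y))) :=
    ((G.continuous_rightDet.comp ((G.continuous_dilation x).prodMk
      (G.continuous_dilation y))).tendsto 0).mono_left nhdsWithin_le_nhds
  have h2 : Tendsto (fun R : ℝ => G.rightDet (G.dilation R x, G.dilation R y)) (𝓝[>] 0)
      (𝓝 (G.rightDet (x, y))) :=
    tendsto_const_nhds.congr' (eventually_nhdsWithin_of_forall fun R hR =>
      (G.rightDet_dilation hR x y).symm)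
  rw [tendsto_nhds_unique h2 h1, dilation_zero_left, dilation_zero_left]
  have : (fun z => G.mul z 0) = id := by ext1 z; simp [G.mul_zero]
  simp [rightDet, this, ContinuousLinearMap.det]

/-- Left-invariant fields differentiate along right translations, so this invariance is what moves a
difference quotient from one factor of an integral to the other. -/
lemma integral_mul_right {F : Type*} [NormedAddCommGroup F] [NormedSpace ℝ F]
    (g : (Fin n → ℝ) → F) (y : Fin n → ℝ) : ∫ x, g (G.mul x y) = ∫ x, g x := by
  have h := integral_image_eq_integral_abs_det_fderiv_smul volume (s := univ)
    (f := fun x => G.mul x y) MeasurableSet.univ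
    (fun x _ => ((G.differentiable_mul_right y) x).hasFDerivAt.hasFDerivWithinAt)
    (fun a _ c _ hac => by
      have := congrArg (fun z => G.mul z (G.inv y)) hac
      simpa [G.mul_inv_cancel_right] using this) g
  have hi : (fun x => G.mul x y) '' univ = univ := by
    rw [image_univ, range_eq_univ]
    exact fun x => ⟨G.mul x (G.inv y), G.inv_mul_cancel_right x y⟩
  have hd : ∀ x, (fderiv ℝ (fun x => G.mul x y) x).det = 1 := fun x => G.rightDet_eq_one x y
  rw [hi] at h
  simpa [hd] using h.symm

/-- The curve `t ↦ x ∘ (t eⱼ)` has velocity `X_j` at `t = 0`. -/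
lemma hasDerivAt_comp_mul_single {h : (Fin n → ℝ) → ℝ} {x : Fin n → ℝ}
    (hh : DifferentiableAt ℝ h x) (j : Fin n) :
    HasDerivAt (fun t : ℝ => h (G.mul x (Pi.single j t))) (fderiv ℝ h x (G.X j x)) 0 := by
  have h1 : HasDerivAt (fun t : ℝ => (Pi.single j t : Fin n → ℝ)) (Pi.single j 1) 0 := by
    have := (ContinuousLinearMap.single ℝ (fun _ : Fin n => ℝ) j).hasDerivAt (x := 0)
    simpa using this
  have h2 : HasFDerivAt (fun y => G.mul x y) (fderiv ℝ (fun y => G.mul x y) 0)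
      (Pi.single j (0 : ℝ)) := by
    simpa using ((G.differentiable_mul_left x) 0).hasFDerivAt
  have h3 := h2.comp_hasDerivAt (0 : ℝ) h1
  have h4 : HasFDerivAt h (fderiv ℝ h x) (G.mul x (Pi.single j (0 : ℝ))) := by
    simpa [G.mul_zero] using hh.hasFDerivAt
  exact h4.comp_hasDerivAt (0 : ℝ) h3

lemma contDiff_X (j : Fin n) : ContDiff ℝ ∞ (G.X j) := by
  have : ContDiff ℝ ∞ fun x : Fin n → ℝ => fderiv ℝ (fun y => G.mul x y) 0 := by
    refine ContDiff.fderiv (m := ∞) (n := ∞) (f := fun x : Fin n → ℝ => fun y => G.mul x y) ?_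
      contDiff_const (by simp)
    exact G.contDiff_mul_comp contDiff_fst contDiff_snd
  exact this.clm_apply contDiff_const

/-- Horizontal derivatives are homogeneous of degree one. -/
lemma fderiv_comp_dilation_X {h : (Fin n → ℝ) → ℝ} (hh : Differentiable ℝ h) (j : G.Hor)
    {R : ℝ} (hR : 0 < R) (x : Fin n → ℝ) :
    fderiv ℝ (fun z => h (G.dilation R z)) x (G.X j x) =
      R * fderiv ℝ h (G.dilation R x) (G.X j (G.dilation R x)) := by
  have hd : Differentiable ℝ fun z => h (G.dilation R z) := by
    simpa [Function.comp_def, dilationCLM_apply] using hh.comp (G.dilationCLM R).differentiable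
  have h1 := G.hasDerivAt_comp_mul_single (hd x) j
  have h2 : HasDerivAt (fun t : ℝ => h (G.mul (G.dilation R x) (Pi.single (j : Fin n) t)))
      (fderiv ℝ h (G.dilation R x) (G.X j (G.dilation R x))) (R * 0) := by
    rw [MulZeroClass.mul_zero]
    exact G.hasDerivAt_comp_mul_single (hh _) j
  have h3 := h2.comp 0 ((hasDerivAt_id (0 : ℝ)).const_mul R)
  simp only [G.dilation_mul' hR, G.dilation_single j.2] at h1
  have := h1.unique h3
  simpa [_root_.mul_comm] using this

end HomogeneousLieGroup

end

/-! ### Homogeneous norms and Lipschitz functions. -/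

section

open scoped ContDiff Topology
open Filter

namespace HomogeneousCarnotGroup

variable {n : ℕ} {G : HomogeneousCarnotGroup n} {r : (Fin n → ℝ) → ℝ}

namespace IsHomogeneousNorm

lemma nonneg (hr : G.IsHomogeneousNorm r) (x : Fin n → ℝ) : 0 ≤ r x := by
  by_cases h : x = 0
  · rw [h, hr.zero]
  · exact (hr.pos x h).le

/-- Take for m the minimum of r on the Euclidean sphere of radius ε. If ‖z‖ ≥ ε, some dilate with
factor R ≤ 1 lies on that sphere, and there R r(z) ≥ m. -/
lemma exists_norm_lt_of_lt (hr : G.IsHomogeneousNorm r) {ε : ℝ} (hε : 0 < ε) :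
    ∃ m > 0, ∀ z, r z < m → ‖z‖ < ε := by
  obtain ⟨m, hm, hmin⟩ : ∃ m > 0, ∀ z ∈ Metric.sphere (0 : Fin n → ℝ) ε, m ≤ r z := by
    by_cases hne : (Metric.sphere (0 : Fin n → ℝ) ε).Nonempty
    · obtain ⟨z, hz, hmin⟩ := (isCompact_sphere (0 : Fin n → ℝ) ε).exists_isMinOn hne
        hr.continuous.continuousOn
      refine ⟨r z, hr.pos z ?_, fun y hy => hmin hy⟩
      rintro rfl
      simp at hz
      exact hε.ne hz
    · exact ⟨1, one_pos, fun z hz => (hne ⟨z, hz⟩).elim⟩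
  refine ⟨m, hm, fun z hz => ?_⟩
  by_contra! hge
  have hc : ContinuousOn (fun R : ℝ => ‖G.dilation R z‖) (Icc 0 1) :=
    (G.continuous_dilation z).norm.continuousOn
  have hmem : ε ∈ Icc ‖G.dilation 0 z‖ ‖G.dilation 1 z‖ := by
    rw [G.dilation_zero_left, G.dilation_one, norm_zero]
    exact ⟨hε.le, hge⟩
  obtain ⟨R, hR, hRe⟩ := intermediate_value_Icc zero_le_one hc hmem
  have hRe' : ‖G.dilation R z‖ = ε := hRe
  have hR0 : 0 < R := by
    rcases hR.1.eq_or_lt with h | h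
    · rw [← h, G.dilation_zero_left, norm_zero] at hRe'
      exact absurd hRe' hε.ne
    · exact h
  have h1 := hmin (G.dilation R z) (by simpa using hRe')
  rw [hr.dilation R hR0] at h1
  nlinarith [hr.nonneg z, hR.2]

lemma eventually_of_norm_small (hr : G.IsHomogeneousNorm r) {s : Set (Fin n → ℝ)}
    (hs : s ∈ 𝓝 (0 : Fin n → ℝ)) : ∃ m > 0, ∀ z, r z < m → z ∈ s := by
  obtain ⟨ε, hε, hsub⟩ := Metric.mem_nhds_iff.1 hs
  obtain ⟨m, hm, h⟩ := hr.exists_norm_lt_of_lt hε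
  exact ⟨m, hm, fun z hz => hsub (by simpa using h z hz)⟩

/-- Near the unit the homogeneous norm dominates the Euclidean one. -/
lemma exists_norm_le (hr : G.IsHomogeneousNorm r) :
    ∃ c > 0, ∀ᶠ z in 𝓝 (0 : Fin n → ℝ), ‖z‖ ≤ c * r z := by
  obtain ⟨m, hm, h⟩ := hr.exists_norm_lt_of_lt one_pos
  refine ⟨2 / m, by positivity, ?_⟩
  have h0 : ∀ᶠ z in 𝓝 (0 : Fin n → ℝ), r z < m / 2 := by
    have := hr.continuous.tendsto 0
    rw [hr.zero] at this
    exact this.eventually (gt_mem_nhds (by positivity))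
  filter_upwards [h0] with z hz
  by_cases hz0 : z = 0
  · simp [hz0, hr.zero]
  have hρ := hr.pos z hz0
  -- With this factor r(δ_R z) = m/2. It is at least 1 near the unit, so R ≤ R ^ deg i and all
  -- layers obey the same linear bound.
  set R := m / (2 * r z) with hR
  have hR1 : 1 ≤ R := by rw [hR, le_div_iff₀ (by positivity)]; linarith
  have hR0 : 0 < R := by linarith
  have h1 : ‖G.dilation R z‖ < 1 := by
    apply h
    rw [hr.dilation R hR0, hR]
    field_simp
    linarith
  refine (pi_norm_le_iff_of_nonneg (by positivity)).2 fun i => ?_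
  have h2 : ‖G.dilation R z i‖ < 1 := (norm_le_pi_norm _ i).trans_lt h1
  simp only [HomogeneousLieGroup.dilation, norm_mul, Real.norm_eq_abs, abs_pow, abs_of_pos hR0] at h2
  have h3 : R ≤ R ^ G.deg i := le_self_pow₀ hR1 (by have := G.deg_pos i; omega)
  have h4 : R * |z i| < 1 := by nlinarith [abs_nonneg (z i)]
  rw [Real.norm_eq_abs]
  have : 2 / m * r z = R⁻¹ := by rw [hR]; field_simp
  rw [this, ← one_div, le_div_iff₀ hR0]
  linarith

lemma single {j : G.Hor} (hr : G.IsHomogeneousNorm r) {t : ℝ} (ht : 0 < t) :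
    r (Pi.single (j : Fin n) t) = t * r (Pi.single (j : Fin n) 1) := by
  rw [← hr.dilation t ht, G.dilation_single j.2, mul_one]

end IsHomogeneousNorm

/-- Local Lipschitz continuity, expressed by right translations. -/
def LipNear (G : HomogeneousCarnotGroup n) (r u : (Fin n → ℝ) → ℝ) : Prop :=
  ∀ x₀, ∃ L, 0 ≤ L ∧ ∀ᶠ p in 𝓝 (x₀, (0 : Fin n → ℝ)), |u (G.mul p.1 p.2) - u p.1| ≤ L * r p.2

lemma tendsto_mul_nhds_zero (x₀ : Fin n → ℝ) :
    Tendsto (fun p : (Fin n → ℝ) × (Fin n → ℝ) => G.mul p.1 p.2) (𝓝 (x₀, 0)) (𝓝 x₀) := by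
  have h := G.contDiff_mul.continuous.tendsto (x₀, (0 : Fin n → ℝ))
  simpa [G.mul_zero] using h

lemma tendsto_fst_nhds (x₀ : Fin n → ℝ) :
    Tendsto (fun p : (Fin n → ℝ) × (Fin n → ℝ) => p.1) (𝓝 (x₀, 0)) (𝓝 x₀) :=
  continuous_fst.tendsto (x₀, (0 : Fin n → ℝ))

lemma IsLipLoc.lipNear (hr : G.IsHomogeneousNorm r) {u : (Fin n → ℝ) → ℝ} (hu : G.IsLipLoc r u) :
    G.LipNear r u := by
  intro x₀
  obtain ⟨S, hS, C, hC, h⟩ := hu x₀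
  refine ⟨C, hC.le, ?_⟩
  filter_upwards [tendsto_mul_nhds_zero x₀ hS, tendsto_fst_nhds x₀ hS] with p h1 h2
  have e1 := h _ h1 _ h2
  have e2 := h _ h2 _ h1
  rw [G.inv_mul_cancel_left] at e2
  rw [G.inv_mul_rev, G.mul_assoc, G.inv_mul_cancel, G.mul_zero, hr.symm] at e1
  rw [abs_le]
  constructor <;> linarith

namespace LipNear

variable {u v : (Fin n → ℝ) → ℝ}

lemma continuous (hr : G.IsHomogeneousNorm r) (hu : G.LipNear r u) : Continuous u := by
  refine continuous_iff_continuousAt.2 fun x₀ => ?_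
  obtain ⟨L, hL, h⟩ := hu x₀
  have hc : Tendsto (fun y => (x₀, G.mul (G.inv x₀) y)) (𝓝 x₀) (𝓝 (x₀, (0 : Fin n → ℝ))) := by
    have : Continuous fun y => (x₀, G.mul (G.inv x₀) y) :=
      continuous_const.prodMk (G.continuous_mul_comp continuous_const continuous_id)
    simpa [G.inv_mul_cancel] using this.tendsto x₀
  have h1 := hc.eventually h
  simp only [G.mul_inv_cancel_left] at h1
  rw [ContinuousAt, tendsto_iff_norm_sub_tendsto_zero]
  have h2 : Tendsto (fun y => L * r (G.mul (G.inv x₀) y)) (𝓝 x₀) (𝓝 0) := by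
    have : Continuous fun y => L * r (G.mul (G.inv x₀) y) :=
      continuous_const.mul (hr.continuous.comp (G.continuous_mul_comp continuous_const continuous_id))
    simpa [G.inv_mul_cancel, hr.zero] using this.tendsto x₀
  exact squeeze_zero' (Eventually.of_forall fun y => norm_nonneg _) h1 h2

lemma exists_uniform (hr : G.IsHomogeneousNorm r) (hu : G.LipNear r u) {K : Set (Fin n → ℝ)}
    (hK : IsCompact K) :
    ∃ L, 0 ≤ L ∧ ∃ δ > 0, ∀ x ∈ K, ∀ z, r z < δ → |u (G.mul x z) - u x| ≤ L * r z := by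
  refine hK.induction_on (p := fun s => ∃ L, 0 ≤ L ∧ ∃ δ > 0, ∀ x ∈ s, ∀ z, r z < δ →
    |u (G.mul x z) - u x| ≤ L * r z) ⟨0, le_rfl, 1, one_pos, by simp⟩ ?_ ?_ ?_
  · rintro s t hst ⟨L, hL, δ, hδ, h⟩
    exact ⟨L, hL, δ, hδ, fun x hx => h x (hst hx)⟩
  · rintro s t ⟨L, hL, δ, hδ, h⟩ ⟨L', hL', δ', hδ', h'⟩
    refine ⟨max L L', le_max_of_le_left hL, min δ δ', lt_min hδ hδ', ?_⟩
    rintro x (hx | hx) z hz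
    · exact (h x hx z (hz.trans_le (min_le_left _ _))).trans
        (mul_le_mul_of_nonneg_right (le_max_left _ _) (hr.nonneg z))
    · exact (h' x hx z (hz.trans_le (min_le_right _ _))).trans
        (mul_le_mul_of_nonneg_right (le_max_right _ _) (hr.nonneg z))
  · intro x₀ _
    obtain ⟨L, hL, h⟩ := hu x₀
    rw [nhds_prod_eq] at h
    obtain ⟨S, hS, T, hT, hST⟩ := eventually_prod_iff.1 h
    obtain ⟨m, hm, hmT⟩ := hr.eventually_of_norm_small (s := {z | T z}) hT
    exact ⟨{x | S x}, mem_nhdsWithin_of_mem_nhds hS, L, hL, m, hm,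
      fun x hx z hz => hST hx (hmT z hz)⟩

/-- Pairs at distance less than δ use the uniform local constant on the support, from whichever
point lies in it. For other pairs the oscillation is at most 2B ≤ (2B/δ) ρ. -/
lemma isLipOn_univ (hr : G.IsHomogeneousNorm r) (hu : G.LipNear r u) (hc : HasCompactSupport u) :
    G.IsLipOn r u univ := by
  obtain ⟨L, hL, δ, hδ, h⟩ := hu.exists_uniform hr hc
  obtain ⟨B, hB⟩ := hc.exists_bound_of_continuous (hu.continuous hr)
  have hB0 : 0 ≤ B := (norm_nonneg _).trans (hB 0)
  refine ⟨L + 2 * B / δ + 1, by positivity, fun x _ y _ => ?_⟩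
  have hsymm : r (G.mul (G.inv y) x) = r (G.mul (G.inv x) y) := by
    rw [← hr.symm, G.inv_mul_rev, G.inv_inv]
  have hz0 := hr.nonneg (G.mul (G.inv x) y)
  set ρ := r (G.mul (G.inv x) y)
  have hBδ : 0 ≤ 2 * B / δ := by positivity
  by_cases hlt : ρ < δ
  · suffices hs : u x - u y ≤ L * ρ by nlinarith [mul_nonneg hBδ hz0]
    by_cases hx : x ∈ tsupport u
    · have := h x hx (G.mul (G.inv x) y) hlt
      rw [G.mul_inv_cancel_left] at this
      linarith [(abs_le.1 this).1]
    · by_cases hy : y ∈ tsupport u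
      · have := h y hy (G.mul (G.inv y) x) (by rwa [hsymm])
        rw [G.mul_inv_cancel_left, hsymm] at this
        linarith [(abs_le.1 this).2]
      · rw [image_eq_zero_of_notMem_tsupport hx, image_eq_zero_of_notMem_tsupport hy]
        simpa using mul_nonneg hL hz0
  · have h1 : 2 * B ≤ 2 * B / δ * ρ := by
      rw [div_mul_eq_mul_div, le_div_iff₀ hδ]
      exact mul_le_mul_of_nonneg_left (not_lt.1 hlt) (by positivity)
    have h2 := (abs_le.1 (hB x)).2
    have h3 := (abs_le.1 (hB y)).1
    nlinarith [mul_nonneg hL hz0]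

/-- The map (x, z) ↦ u(x ∘ z) is locally Lipschitz in the Euclidean sense, and ‖z‖ is at most a
multiple of r(z) near the unit. -/
lemma of_contDiff (hr : G.IsHomogeneousNorm r) (hu : ContDiff ℝ ∞ u) : G.LipNear r u := by
  intro x₀
  have h1 : ContDiff ℝ 1 fun p : (Fin n → ℝ) × (Fin n → ℝ) => u (G.mul p.1 p.2) :=
    (hu.comp G.contDiff_mul).of_le (by norm_cast)
  obtain ⟨K, t, ht, hK⟩ := (h1.contDiffAt (x := (x₀, 0))).exists_lipschitzOnWith
  obtain ⟨c, hc, hcz⟩ := hr.exists_norm_le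
  refine ⟨K * c, by positivity, ?_⟩
  have e1 : ∀ᶠ p : (Fin n → ℝ) × (Fin n → ℝ) in 𝓝 (x₀, 0), ‖p.2‖ ≤ c * r p.2 :=
    (continuous_snd.tendsto (x₀, (0 : Fin n → ℝ))).eventually hcz
  have e2 : ∀ᶠ p : (Fin n → ℝ) × (Fin n → ℝ) in 𝓝 (x₀, 0), (p.1, (0 : Fin n → ℝ)) ∈ t := by
    have : Continuous fun p : (Fin n → ℝ) × (Fin n → ℝ) => (p.1, (0 : Fin n → ℝ)) := by fun_prop
    exact (this.tendsto (x₀, (0 : Fin n → ℝ))).eventually ht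
  filter_upwards [ht, e1, e2] with p hp h2 h3
  have := hK.dist_le_mul p hp _ h3
  rw [Real.dist_eq, G.mul_zero] at this
  refine this.trans ?_
  rw [mul_assoc]
  refine mul_le_mul_of_nonneg_left (le_trans ?_ h2) K.2
  rw [Prod.dist_eq]
  simp

lemma mul (hr : G.IsHomogeneousNorm r) (hu : G.LipNear r u) (hv : G.LipNear r v) :
    G.LipNear r fun x => u x * v x := by
  intro x₀
  obtain ⟨L, hL, h⟩ := hu x₀
  obtain ⟨M, hM, h'⟩ := hv x₀
  have hu1 : ∀ᶠ p : (Fin n → ℝ) × (Fin n → ℝ) in 𝓝 (x₀, 0), |u (G.mul p.1 p.2)| < |u x₀| + 1 :=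
    ((hu.continuous hr).abs.continuousAt.tendsto.comp (tendsto_mul_nhds_zero x₀)).eventually
      (gt_mem_nhds (lt_add_one _))
  have hv1 : ∀ᶠ p : (Fin n → ℝ) × (Fin n → ℝ) in 𝓝 (x₀, 0), |v p.1| < |v x₀| + 1 :=
    ((hv.continuous hr).abs.continuousAt.tendsto.comp (tendsto_fst_nhds x₀)).eventually
      (gt_mem_nhds (lt_add_one _))
  refine ⟨(|u x₀| + 1) * M + (|v x₀| + 1) * L, by positivity, ?_⟩
  filter_upwards [h, h', hu1, hv1] with p h1 h2 h3 h4
  have h0 := hr.nonneg p.2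
  calc |u (G.mul p.1 p.2) * v (G.mul p.1 p.2) - u p.1 * v p.1|
      = |u (G.mul p.1 p.2) * (v (G.mul p.1 p.2) - v p.1) + v p.1 * (u (G.mul p.1 p.2) - u p.1)| := by
        congr 1; ring
    _ ≤ |u (G.mul p.1 p.2)| * |v (G.mul p.1 p.2) - v p.1| + |v p.1| * |u (G.mul p.1 p.2) - u p.1| := by
        rw [← abs_mul, ← abs_mul]; exact abs_add_le _ _
    _ ≤ (|u x₀| + 1) * (M * r p.2) + (|v x₀| + 1) * (L * r p.2) := by gcongr
    _ = _ := by ring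

lemma comp (hr : G.IsHomogeneousNorm r) (hu : G.LipNear r u) {F : ℝ → ℝ} (hF : ContDiff ℝ 1 F) :
    G.LipNear r fun x => F (u x) := by
  intro x₀
  obtain ⟨L, hL, h⟩ := hu x₀
  obtain ⟨K, t, ht, hK⟩ := (hF.contDiffAt (x := u x₀)).exists_lipschitzOnWith
  have hc := (hu.continuous hr).tendsto x₀
  refine ⟨K * L, by positivity, ?_⟩
  filter_upwards [h, (hc.comp (tendsto_mul_nhds_zero x₀)).eventually ht,
    (hc.comp (tendsto_fst_nhds x₀)).eventually ht] with p h1 h2 h3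
  refine (hK.dist_le_mul _ h2 _ h3).trans ?_
  rw [mul_assoc]
  exact mul_le_mul_of_nonneg_left h1 K.2

end LipNear

end HomogeneousCarnotGroup

end

/-! ### Difference quotients and the calculus of weak gradients. -/

section

open scoped ContDiff Topology
open Filter

namespace HomogeneousCarnotGroup

variable {n : ℕ} {G : HomogeneousCarnotGroup n} {r : (Fin n → ℝ) → ℝ}

/-- The difference quotient of `u` along the curve `t ↦ t eⱼ`. -/
noncomputable def diffQuot (G : HomogeneousCarnotGroup n) (j : G.Hor) (u : (Fin n → ℝ) → ℝ) (t : ℝ)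
    (x : Fin n → ℝ) : ℝ :=
  t⁻¹ * (u x - u (G.mul x (G.inv (Pi.single (j : Fin n) t))))

lemma continuous_diffQuot (j : G.Hor) {u : (Fin n → ℝ) → ℝ} (hu : Continuous u) (t : ℝ) :
    Continuous (G.diffQuot j u t) :=
  continuous_const.mul (hu.sub (hu.comp (G.continuous_mul_comp continuous_id continuous_const)))

lemma continuous_single_real (j : Fin n) : Continuous fun t : ℝ => (Pi.single j t : Fin n → ℝ) :=
  _root_.continuous_single (A := fun _ : Fin n => ℝ) j

lemma eventually_single_lt (hr : G.IsHomogeneousNorm r) (j : G.Hor) {δ : ℝ} (hδ : 0 < δ) :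
    ∀ᶠ t : ℝ in 𝓝[>] 0, r (Pi.single (j : Fin n) t) < δ := by
  have h : Tendsto (fun t : ℝ => r (Pi.single (j : Fin n) t)) (𝓝 0) (𝓝 0) := by
    have := (hr.continuous.comp (continuous_single_real (j : Fin n))).tendsto 0
    simpa [hr.zero, Function.comp_def] using this
  exact (h.mono_left nhdsWithin_le_nhds).eventually (gt_mem_nhds hδ)

lemma LipNear.exists_abs_diffQuot_le (hr : G.IsHomogeneousNorm r) {u : (Fin n → ℝ) → ℝ}
    (hu : G.LipNear r u) (j : G.Hor) {K : Set (Fin n → ℝ)} (hK : IsCompact K) :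
    ∃ L, 0 ≤ L ∧ ∀ᶠ t : ℝ in 𝓝[>] 0, ∀ x ∈ K, |G.diffQuot j u t x| ≤ L := by
  obtain ⟨L, hL, δ, hδ, h⟩ := hu.exists_uniform hr hK
  refine ⟨L * r (Pi.single (j : Fin n) 1), mul_nonneg hL (hr.nonneg _), ?_⟩
  filter_upwards [eventually_single_lt hr j hδ, self_mem_nhdsWithin] with t ht ht0 x hx
  have ht0 : 0 < t := ht0
  have := h x hx (G.inv (Pi.single (j : Fin n) t)) (by rwa [hr.symm])
  rw [hr.symm, hr.single ht0, abs_sub_comm] at this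
  rw [diffQuot, abs_mul, abs_of_pos (inv_pos.2 ht0), inv_mul_le_iff₀ ht0]
  linarith

/-- Translation invariance turns the backward quotient of w into minus the forward quotient of h,
which converges to X_j h under a uniform bound. Thus w need only be continuous. -/
lemma tendsto_integral_diffQuot (hr : G.IsHomogeneousNorm r) {w h : (Fin n → ℝ) → ℝ}
    (hw : Continuous w) (hh : ContDiff ℝ ∞ h) (hc : HasCompactSupport h) (j : G.Hor) :
    Tendsto (fun t => ∫ x, G.diffQuot j w t x * h x) (𝓝[>] 0)
      (𝓝 (-∫ x, w x * fderiv ℝ h x (G.X j x))) := by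
  have hhc := hh.continuous
  have heq : ∀ t, ∫ x, G.diffQuot j w t x * h x =
      ∫ x, -(w x * (t⁻¹ * (h (G.mul x (Pi.single (j : Fin n) t)) - h x))) := by
    intro t
    have hct : HasCompactSupport fun x => h (G.mul x (Pi.single (j : Fin n) t)) := by
      refine HasCompactSupport.intro (K := (fun y => G.mul y (G.inv (Pi.single (j : Fin n) t))) '' tsupport h)
        (hc.image (G.continuous_mul_comp continuous_id continuous_const)) fun x hx => ?_
      by_contra hne
      exact hx ⟨_, subset_tsupport _ hne, G.mul_inv_cancel_right _ _⟩
    have hcont : Continuous fun x => h (G.mul x (Pi.single (j : Fin n) t)) :=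
      hhc.comp (G.continuous_mul_comp continuous_id continuous_const)
    have i1 : Integrable fun x => t⁻¹ * (w x * h x) :=
      ((hw.mul hhc).integrable_of_hasCompactSupport hc.mul_left).const_mul _
    have i2 : Integrable fun x => t⁻¹ * (w x * h (G.mul x (Pi.single (j : Fin n) t))) :=
      ((hw.mul hcont).integrable_of_hasCompactSupport hct.mul_left).const_mul _
    have e2 : ∫ x, t⁻¹ * (w (G.mul x (G.inv (Pi.single (j : Fin n) t))) * h x) =
        ∫ x, t⁻¹ * (w x * h (G.mul x (Pi.single (j : Fin n) t))) := by
      rw [← G.integral_mul_right (fun x => t⁻¹ * (w (G.mul x (G.inv (Pi.single (j : Fin n) t))) * h x))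
        (Pi.single (j : Fin n) t)]
      simp only [G.mul_inv_cancel_right]
    have i3 : Integrable fun x => t⁻¹ * (w (G.mul x (G.inv (Pi.single (j : Fin n) t))) * h x) :=
      (((hw.comp (G.continuous_mul_comp continuous_id continuous_const)).mul
        hhc).integrable_of_hasCompactSupport hc.mul_left).const_mul _
    calc ∫ x, G.diffQuot j w t x * h x
        = ∫ x, (t⁻¹ * (w x * h x) -
            t⁻¹ * (w (G.mul x (G.inv (Pi.single (j : Fin n) t))) * h x)) := by
          congr 1; ext x; simp only [diffQuot]; ring
      _ = ∫ x, (t⁻¹ * (w x * h x) - t⁻¹ * (w x * h (G.mul x (Pi.single (j : Fin n) t)))) := by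
          rw [integral_sub i1 i3, e2, integral_sub i1 i2]
      _ = _ := by congr 1; ext x; ring
  simp only [heq]
  rw [← integral_neg]
  -- This compact set contains the support of h and those of all its translates with t in [0, 1], so
  -- one dominating function serves all small t.
  set K' : Set (Fin n → ℝ) := (fun p : (Fin n → ℝ) × ℝ => G.mul p.1 (G.inv (Pi.single (j : Fin n) p.2)))
    '' (tsupport h ×ˢ Icc 0 1) ∪ tsupport h with hK'
  have hK'c : IsCompact K' := by
    refine IsCompact.union ((IsCompact.prod hc isCompact_Icc).image ?_) hc
    exact G.continuous_mul_comp continuous_fst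
      (G.contDiff_inv.continuous.comp ((continuous_single_real (j : Fin n)).comp continuous_snd))
  obtain ⟨L, hL, δ, hδ, hu⟩ := (LipNear.of_contDiff hr hh).exists_uniform hr hK'c
  set e := r (Pi.single (j : Fin n) 1)
  have he : 0 ≤ e := hr.nonneg _
  refine tendsto_integral_filter_of_dominated_convergence
    (K'.indicator fun x => |w x| * (L * e)) ?_ ?_ ?_ ?_
  · refine Eventually.of_forall fun t => Continuous.aestronglyMeasurable ?_
    exact (hw.mul (continuous_const.mul ((hhc.comp
      (G.continuous_mul_comp continuous_id continuous_const)).sub hhc))).neg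
  · filter_upwards [eventually_single_lt hr j hδ, self_mem_nhdsWithin,
      mem_nhdsWithin_of_mem_nhds (gt_mem_nhds (zero_lt_one' ℝ))] with t ht ht0 ht1
    have ht0 : 0 < t := ht0
    refine Eventually.of_forall fun x => ?_
    by_cases hx : x ∈ K'
    · rw [indicator_of_mem hx, norm_neg, norm_mul, Real.norm_eq_abs]
      refine mul_le_mul_of_nonneg_left ?_ (abs_nonneg _)
      rw [Real.norm_eq_abs, abs_mul, abs_of_pos (inv_pos.2 ht0), inv_mul_le_iff₀ ht0]
      have := hu x hx _ ht
      rw [hr.single ht0] at this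
      linarith
    · have h1 : h x = 0 := image_eq_zero_of_notMem_tsupport fun hx' => hx (Or.inr hx')
      have h2 : h (G.mul x (Pi.single (j : Fin n) t)) = 0 := by
        refine image_eq_zero_of_notMem_tsupport fun hx' => hx (Or.inl ?_)
        exact ⟨(_, t), ⟨hx', ht0.le, ht1.le⟩, G.mul_inv_cancel_right _ _⟩
      simp [indicator_of_notMem hx, h1, h2]
  · rw [integrable_indicator_iff hK'c.measurableSet]
    exact (hw.abs.mul continuous_const).continuousOn.integrableOn_compact hK'c
  · refine Eventually.of_forall fun x => ?_
    have hd := (G.hasDerivAt_comp_mul_single (hh.differentiable (by simp) x) (j : Fin n)).tendsto_slope_zero_right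
    simp only [zero_add, Pi.single_zero, G.mul_zero, smul_eq_mul] at hd
    exact (hd.const_mul (w x)).neg

lemma abs_integral_mul_sub_le {f g h : (Fin n → ℝ) → ℝ} {K : Set (Fin n → ℝ)} (hK : IsCompact K)
    {η : ℝ} (hf : LocallyIntegrable f) (hh : Continuous h) (hhK : tsupport h ⊆ K)
    (hg : Continuous g) (hgK : tsupport g ⊆ K) (hgh : ∀ x, |h x - g x| ≤ η) :
    |(∫ x, f x * h x) - ∫ x, f x * g x| ≤ η * ∫ x in K, |f x| := by
  have i1 : ∀ k : (Fin n → ℝ) → ℝ, Continuous k → tsupport k ⊆ K → Integrable fun x => f x * k x :=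
    fun k hk hkK => hf.integrable_smul_right_of_hasCompactSupport hk
      (hK.of_isClosed_subset (isClosed_tsupport _) hkK)
  rw [← integral_sub (i1 h hh hhK) (i1 g hg hgK), ← integral_const_mul,
    ← setIntegral_eq_integral_of_forall_compl_eq_zero (s := K), ← Real.norm_eq_abs]
  · refine norm_integral_le_of_norm_le ((hf.integrableOn_isCompact hK).abs.const_mul η)
      (Eventually.of_forall fun x => ?_)
    rw [← mul_sub, norm_mul, mul_comm, Real.norm_eq_abs, Real.norm_eq_abs]
    exact mul_le_mul_of_nonneg_right (hgh x) (abs_nonneg _)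
  · intro x hx
    rw [image_eq_zero_of_notMem_tsupport fun h' => hx (hhK h'),
      image_eq_zero_of_notMem_tsupport fun h' => hx (hgK h')]
    simp

namespace IsWeakGradient

variable {u : (Fin n → ℝ) → ℝ} {U : (Fin n → ℝ) → EuclideanSpace ℝ G.Hor}

lemma locallyIntegrable_apply (hU : G.IsWeakGradient u U) (j : G.Hor) :
    LocallyIntegrable fun x => U x j := by
  intro x
  obtain ⟨s, hs, h⟩ := hU.1 x
  exact ⟨s, hs, (EuclideanSpace.proj (𝕜 := ℝ) j).integrable_comp h⟩

/-- Difference quotients converge weakly to the weak gradient. -/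
lemma tendsto_integral_diffQuot (hr : G.IsHomogeneousNorm r) (hu : G.LipNear r u)
    (hU : G.IsWeakGradient u U) (j : G.Hor) {h : (Fin n → ℝ) → ℝ} (hh : Continuous h)
    (hc : HasCompactSupport h) :
    Tendsto (fun t => ∫ x, G.diffQuot j u t x * h x) (𝓝[>] 0) (𝓝 (∫ x, U x j * h x)) := by
  have hK : IsCompact (tsupport h) := hc
  obtain ⟨L, hL, hLt⟩ := hu.exists_abs_diffQuot_le hr j hK
  set V := volume.real (tsupport h)
  set I := ∫ x in tsupport h, |U x j|
  have hI : 0 ≤ I := integral_nonneg fun x => abs_nonneg _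
  have hV : 0 ≤ V := measureReal_nonneg
  rw [Metric.tendsto_nhds]
  intro ε hε
  -- The smoothing error in the quotient, the limit error and the smoothing error in U are at most
  -- ηLV, η and ηI, in total ε/2.
  set η := ε / (2 * (L * V + I + 1)) with hη
  have hη0 : 0 < η := by positivity
  obtain ⟨g, hg, hgh, hgs⟩ := hh.exists_contDiff_approx ⊤ (ε := fun _ => η) continuous_const
    fun _ => hη0
  have hg' : ContDiff ℝ ∞ g := hg
  have hgK : tsupport g ⊆ tsupport h := closure_mono hgs
  have hgc : HasCompactSupport g := hK.of_isClosed_subset (isClosed_tsupport g) hgK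
  have hlim := HomogeneousCarnotGroup.tendsto_integral_diffQuot hr (hu.continuous hr) hg' hgc j
  rw [hU.2 j g hg' hgc, neg_neg] at hlim
  have hgη : ∀ x, |h x - g x| ≤ η := fun x => by
    rw [abs_sub_comm, ← Real.dist_eq]; exact (hgh x).le
  have e2 := abs_integral_mul_sub_le hK (hU.locallyIntegrable_apply j) hh subset_rfl hg.continuous hgK hgη
  filter_upwards [hlim.eventually (Metric.ball_mem_nhds _ hη0), hLt] with t ht hLt
  have e1 := abs_integral_mul_sub_le hK
    (continuous_diffQuot (j := j) (hu.continuous hr) t).locallyIntegrable hh subset_rfl hg.continuous hgK hgη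
  have e3 : ∫ x in tsupport h, |G.diffQuot j u t x| ≤ L * V := by
    have := setIntegral_mono_on (μ := volume) (s := tsupport h) (f := fun x => |G.diffQuot j u t x|)
      (g := fun _ => L)
      ((continuous_diffQuot (j := j) (hu.continuous hr) t).abs.continuousOn.integrableOn_compact hK)
      (integrableOn_const hK.measure_lt_top.ne) hK.measurableSet hLt
    simpa [mul_comm] using this
  change dist _ _ < η at ht
  rw [Real.dist_eq] at ht
  rw [Real.dist_eq]
  have e4 : η * ∫ x in tsupport h, |G.diffQuot j u t x| ≤ η * (L * V) := by gcongr
  have e5 : η * (L * V + I + 1) = ε / 2 := by rw [hη]; field_simp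
  calc |(∫ x, G.diffQuot j u t x * h x) - ∫ x, U x j * h x|
      = |((∫ x, G.diffQuot j u t x * h x) - ∫ x, G.diffQuot j u t x * g x) +
          ((∫ x, G.diffQuot j u t x * g x) - ∫ x, U x j * g x) -
          ((∫ x, U x j * h x) - ∫ x, U x j * g x)| := by congr 1; ring
    _ ≤ η * (L * V) + η + η * I := by
        refine (abs_sub _ _).trans (add_le_add ((abs_add_le _ _).trans
          (add_le_add (e1.trans e4) ht.le)) e2)
    _ < ε := by linarith

/-- The weak gradient of a locally Lipschitz function is locally bounded. -/
lemma exists_ae_abs_apply_le (hr : G.IsHomogeneousNorm r) (hu : G.LipNear r u)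
    (hU : G.IsWeakGradient u U) (j : G.Hor) {K : Set (Fin n → ℝ)} (hK : IsCompact K) :
    ∃ L, 0 ≤ L ∧ ∀ᵐ x, x ∈ K → |U x j| ≤ L := by
  -- The unit thickening leaves room for mollifiers centred at points of K.
  obtain ⟨L, hL, hLt⟩ := hu.exists_abs_diffQuot_le hr j (hK.cthickening (r := 1))
  refine ⟨L, hL, ?_⟩
  have key : ∀ h : (Fin n → ℝ) → ℝ, Continuous h → HasCompactSupport h → (∀ x, 0 ≤ h x) →
      tsupport h ⊆ Metric.cthickening 1 K → |∫ x, U x j * h x| ≤ L * ∫ x, h x := by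
    intro h hh hc h0 hs
    refine le_of_tendsto (hU.tendsto_integral_diffQuot hr hu j hh hc).abs ?_
    filter_upwards [hLt] with t ht
    rw [← integral_const_mul, ← Real.norm_eq_abs]
    refine norm_integral_le_of_norm_le ((hh.integrable_of_hasCompactSupport hc).const_mul L)
      (Eventually.of_forall fun x => ?_)
    rw [norm_mul, Real.norm_of_nonneg (h0 x)]
    by_cases hx : x ∈ tsupport h
    · exact mul_le_mul_of_nonneg_right (ht x (hs hx)) (h0 x)
    · simp [image_eq_zero_of_notMem_tsupport hx]
  -- The bound `key` survives the weak limit. Applied to bumps of mass one shrinking to x, it bounds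
  -- U at almost every x.
  let φ : ℕ → ContDiffBump (0 : Fin n → ℝ) := fun k =>
    ⟨1 / (2 * (k + 1)), 1 / (k + 1), by positivity, by
      apply one_div_lt_one_div_of_lt <;> nlinarith [k.cast_nonneg (α := ℝ)]⟩
  have hφ : Tendsto (fun k => (φ k).rOut) atTop (𝓝 0) := tendsto_one_div_add_atTop_nhds_zero_nat
  have h'φ : ∀ᶠ k in atTop, (φ k).rOut ≤ 2 * (φ k).rIn := by
    refine Eventually.of_forall fun k => le_of_eq ?_
    simp only [φ]; field_simp
  filter_upwards [ContDiffBump.ae_convolution_tendsto_right_of_locallyIntegrable (μ := volume) hφ h'φ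
    (hU.locallyIntegrable_apply j)] with x hx hxK
  refine le_of_tendsto hx.abs (Eventually.of_forall fun k => ?_)
  rw [convolution_eq_swap]
  simp only [ContinuousLinearMap.lsmul_apply, smul_eq_mul]
  set ψ := (φ k).normed volume
  have hψc : Continuous fun t => ψ (x - t) := (φ k).continuous_normed.comp (by fun_prop)
  have hsub : tsupport (fun t => ψ (x - t)) ⊆ Metric.closedBall x 1 := by
    refine closure_minimal (fun t ht => ?_) Metric.isClosed_closedBall
    have h1 : x - t ∈ Function.support ψ := ht
    rw [(φ k).support_normed_eq] at h1
    have h2 : (φ k).rOut ≤ 1 := by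
      simp only [φ]
      rw [div_le_one (by positivity)]
      linarith [k.cast_nonneg (α := ℝ)]
    rw [mem_ball_zero_iff] at h1
    rw [Metric.mem_closedBall, dist_comm, dist_eq_norm]
    linarith
  have := key (fun t => ψ (x - t)) hψc
    ((isCompact_closedBall x 1).of_isClosed_subset (isClosed_tsupport _) hsub)
    (fun t => (φ k).nonneg_normed _)
    (hsub.trans (Metric.closedBall_subset_cthickening hxK 1))
  rw [integral_sub_left_eq_self ψ volume x, (φ k).integral_normed, mul_one] at this
  simpa only [mul_comm] using this

lemma exists_ae_norm_le (hr : G.IsHomogeneousNorm r) (hu : G.LipNear r u)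
    (hU : G.IsWeakGradient u U) {K : Set (Fin n → ℝ)} (hK : IsCompact K) :
    ∃ L, 0 ≤ L ∧ ∀ᵐ x, x ∈ K → ‖U x‖ ≤ L := by
  choose L hL h using fun j => hU.exists_ae_abs_apply_le hr hu j hK
  refine ⟨∑ j, L j, Finset.sum_nonneg fun j _ => hL j, ?_⟩
  filter_upwards [ae_all_iff.2 h] with x hx hxK
  calc ‖U x‖ = ‖∑ j, EuclideanSpace.single j (U x j)‖ := by
        congr 1
        ext i
        simp [Finset.sum_apply, Pi.single_apply]
    _ ≤ ∑ j, ‖EuclideanSpace.single j (U x j)‖ := norm_sum_le _ _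
    _ ≤ ∑ j, L j := Finset.sum_le_sum fun j _ => by simpa using hx j hxK

/-- Chain rule. -/
lemma comp (hr : G.IsHomogeneousNorm r) (hu : G.LipNear r u) (hU : G.IsWeakGradient u U)
    {F F' : ℝ → ℝ} (hF : Continuous F) (hF' : Continuous F') {C : ℝ}
    (hquad : ∀ a c, |F c - F a - F' a * (c - a)| ≤ C * (c - a) ^ 2) :
    G.IsWeakGradient (fun x => F (u x)) fun x => F' (u x) • U x := by
  have huc := hu.continuous hr
  refine ⟨?_, fun j h hh hc => ?_⟩
  · have := LocallyIntegrableOn.continuousOn_smul isClosed_univ.isLocallyClosed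
      (locallyIntegrableOn_univ.2 hU.1) (hF'.comp huc).continuousOn
    exact locallyIntegrableOn_univ.1 this
  have hhc := hh.continuous
  have h1 := HomogeneousCarnotGroup.tendsto_integral_diffQuot hr (hF.comp huc) hh hc j
  -- The factor F'(u) h is only continuous, hence the need for weak convergence against continuous
  -- test functions.
  have h2 := hU.tendsto_integral_diffQuot hr hu j (h := fun x => F' (u x) * h x)
    ((hF'.comp huc).mul hhc) hc.mul_left
  obtain ⟨L, hL, hLt⟩ := hu.exists_abs_diffQuot_le hr j (K := tsupport h) hc
  have hC : 0 ≤ C := by simpa using (abs_nonneg _).trans (hquad 0 1)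
  -- On the support of h the increments of u are at most tL, so the quadratic remainder divided by t
  -- is O(t).
  have h3 : Tendsto (fun t => (∫ x, G.diffQuot j (F ∘ u) t x * h x) -
      ∫ x, G.diffQuot j u t x * (F' (u x) * h x)) (𝓝[>] 0) (𝓝 0) := by
    have hlim : Tendsto (fun t : ℝ => t * (C * L ^ 2 * ∫ x, |h x|)) (𝓝[>] 0) (𝓝 0) := by
      have : Tendsto (fun t : ℝ => t * (C * L ^ 2 * ∫ x, |h x|)) (𝓝 0) (𝓝 (0 * _)) :=
        tendsto_id.mul_const _
      rw [zero_mul] at this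
      exact this.mono_left nhdsWithin_le_nhds
    refine squeeze_zero_norm' ?_ hlim
    filter_upwards [hLt, self_mem_nhdsWithin] with t ht ht0
    have ht0 : 0 < t := ht0
    rw [← integral_sub (f := fun x => G.diffQuot j (F ∘ u) t x * h x)
      (g := fun x => G.diffQuot j u t x * (F' (u x) * h x))
      (((continuous_diffQuot j (hF.comp huc) t).mul hhc).integrable_of_hasCompactSupport hc.mul_left)
      (((continuous_diffQuot j huc t).mul ((hF'.comp huc).mul
        hhc)).integrable_of_hasCompactSupport hc.mul_left.mul_left),
      ← integral_const_mul, ← integral_const_mul]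
    refine norm_integral_le_of_norm_le
      (((hhc.abs.integrable_of_hasCompactSupport hc.norm).const_mul _).const_mul _)
      (Eventually.of_forall fun x => ?_)
    by_cases hx : x ∈ tsupport h
    · have hD := ht x hx
      set y := G.mul x (G.inv (Pi.single (j : Fin n) t)) with hy
      have hq := hquad (u x) (u y)
      have hdq : u x - u y = t * G.diffQuot j u t x := by
        rw [diffQuot, ← hy, mul_inv_cancel_left₀ ht0.ne']
      have e1 : G.diffQuot j (F ∘ u) t x * h x - G.diffQuot j u t x * (F' (u x) * h x) =
          -(t⁻¹ * (F (u y) - F (u x) - F' (u x) * (u y - u x))) * h x := by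
        simp only [diffQuot, ← hy, Function.comp]; ring
      rw [e1, norm_mul, norm_neg, norm_mul, Real.norm_eq_abs, Real.norm_eq_abs, Real.norm_eq_abs,
        abs_of_pos (inv_pos.2 ht0)]
      have e2 : (u y - u x) ^ 2 ≤ t ^ 2 * L ^ 2 := by
        rw [show (u y - u x) ^ 2 = (u x - u y) ^ 2 by ring, hdq, mul_pow]
        refine mul_le_mul_of_nonneg_left ?_ (sq_nonneg t)
        exact sq_le_sq' (by linarith [(abs_le.1 hD).1]) (abs_le.1 hD).2
      have e3 : |F (u y) - F (u x) - F' (u x) * (u y - u x)| ≤ C * (t ^ 2 * L ^ 2) :=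
        hq.trans (by gcongr)
      calc t⁻¹ * |F (u y) - F (u x) - F' (u x) * (u y - u x)| * |h x|
          ≤ t⁻¹ * (C * (t ^ 2 * L ^ 2)) * |h x| := by gcongr
        _ = t * (C * L ^ 2 * |h x|) := by field_simp
    · simp [image_eq_zero_of_notMem_tsupport hx]
  have h4 := tendsto_nhds_unique (h1.sub h2) h3
  simp only [Function.comp_apply] at h4
  have h5 : ∫ x, (F' (u x) • U x) j * h x = ∫ x, U x j * (F' (u x) * h x) := by
    congr 1; ext x; simp; ring
  rw [h5]
  linarith

end IsWeakGradient

/-- The horizontal gradient of a smooth function. -/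
noncomputable def horGrad (G : HomogeneousCarnotGroup n) (ψ : (Fin n → ℝ) → ℝ) (x : Fin n → ℝ) :
    EuclideanSpace ℝ G.Hor :=
  WithLp.toLp 2 fun j => fderiv ℝ ψ x (G.X j x)

lemma continuous_horGrad {ψ : (Fin n → ℝ) → ℝ} (hψ : ContDiff ℝ ∞ ψ) : Continuous (G.horGrad ψ) := by
  refine (PiLp.continuous_toLp 2 _).comp (continuous_pi fun j => ?_)
  exact (hψ.continuous_fderiv (by simp)).clm_apply (G.contDiff_X j).continuous

namespace IsWeakGradient

variable {u : (Fin n → ℝ) → ℝ} {U : (Fin n → ℝ) → EuclideanSpace ℝ G.Hor}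

/-- Product rule with a smooth factor. -/
lemma mul_contDiff (hu : Continuous u) (hU : G.IsWeakGradient u U) {ψ : (Fin n → ℝ) → ℝ}
    (hψ : ContDiff ℝ ∞ ψ) :
    G.IsWeakGradient (fun x => u x * ψ x) fun x => ψ x • U x + u x • G.horGrad ψ x := by
  refine ⟨?_, fun j h hh hc => ?_⟩
  · refine LocallyIntegrable.add ?_ (hu.smul (continuous_horGrad hψ)).locallyIntegrable
    have := LocallyIntegrableOn.continuousOn_smul isClosed_univ.isLocallyClosed
      (locallyIntegrableOn_univ.2 hU.1) hψ.continuous.continuousOn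
    exact locallyIntegrableOn_univ.1 this
  have hψc := hψ.continuous
  have hhc := hh.continuous
  have h1 := hU.2 j (fun x => ψ x * h x) (hψ.mul hh) hc.mul_left
  have hX := (G.contDiff_X (j : Fin n)).continuous
  have hdψ : Continuous fun x => fderiv ℝ ψ x (G.X j x) :=
    (hψ.continuous_fderiv (by simp)).clm_apply hX
  have hdh : Continuous fun x => fderiv ℝ h x (G.X j x) :=
    (hh.continuous_fderiv (by simp)).clm_apply hX
  have hdhc : HasCompactSupport fun x => fderiv ℝ h x (G.X j x) :=
    (hc.fderiv ℝ).mono fun x hx => by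
      contrapose! hx
      simp [Function.notMem_support.1 hx]
  have hd : ∀ x, fderiv ℝ (fun x => ψ x * h x) x (G.X j x) =
      ψ x * fderiv ℝ h x (G.X j x) + h x * fderiv ℝ ψ x (G.X j x) := by
    intro x
    rw [fderiv_fun_mul (hψ.differentiable (by simp) x) (hh.differentiable (by simp) x)]
    simp
  have i1 : Integrable fun x => u x * (ψ x * fderiv ℝ h x (G.X j x)) :=
    (hu.mul (hψc.mul hdh)).integrable_of_hasCompactSupport hdhc.mul_left.mul_left
  have i2 : Integrable fun x => u x * (h x * fderiv ℝ ψ x (G.X j x)) :=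
    (hu.mul (hhc.mul hdψ)).integrable_of_hasCompactSupport hc.mul_right.mul_left
  have i3 : Integrable fun x => U x j * (ψ x * h x) :=
    (hU.locallyIntegrable_apply j).integrable_smul_right_of_hasCompactSupport (hψc.mul hhc)
      hc.mul_left
  simp only [hd, mul_add] at h1
  rw [integral_add i1 i2] at h1
  have e1 : ∫ x, (ψ x • U x + u x • G.horGrad ψ x) j * h x =
      ∫ x, (U x j * (ψ x * h x) + u x * (h x * fderiv ℝ ψ x (G.X j x))) := by
    congr 1; ext x; simp [horGrad]; ring
  have e2 : ∫ x, u x * ψ x * fderiv ℝ h x (G.X j x) = ∫ x, u x * (ψ x * fderiv ℝ h x (G.X j x)) := by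
    congr 1; ext x; ring
  rw [e1, e2, integral_add i3 i2]
  linarith

end IsWeakGradient
end HomogeneousCarnotGroup

end

/-! ### Functions with vanishing weak horizontal gradient. -/

section

open scoped ContDiff Topology
open Filter

namespace HomogeneousCarnotGroup

variable {n : ℕ} {G : HomogeneousCarnotGroup n} {r : (Fin n → ℝ) → ℝ}

/-- After a change of variables, y occurs only in the smooth kernel φ(z ∘ y⁻¹). The integral is the
value at 0 of a convolution with a kernel depending on the parameter y. -/
lemma contDiff_integral_mul_right {w φ : (Fin n → ℝ) → ℝ} (hw : Continuous w)
    (hφ : ContDiff ℝ ∞ φ) (hc : HasCompactSupport φ) :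
    ContDiff ℝ ∞ fun y => ∫ x, w (G.mul x y) * φ x := by
  have heq : ∀ y, ∫ x, w (G.mul x y) * φ x = ∫ z, w z * φ (G.mul z (G.inv y)) := fun y => by
    rw [← G.integral_mul_right (fun z => w z * φ (G.mul z (G.inv y))) y]
    simp only [G.mul_inv_cancel_right]
  simp only [heq]
  refine contDiff_iff_contDiffAt.2 fun y₀ => ?_
  have hk : IsCompact ((fun p : (Fin n → ℝ) × (Fin n → ℝ) => -G.mul p.1 p.2) ''
      (tsupport φ ×ˢ Metric.closedBall y₀ 1)) :=
    (IsCompact.prod hc (isCompact_closedBall y₀ 1)).image G.contDiff_mul.continuous.neg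
  have h := contDiffOn_convolution_right_with_param (𝕜 := ℝ) (n := ⊤) (μ := volume)
    (f := w) (ContinuousLinearMap.mul ℝ ℝ)
    (g := fun p t => φ (G.mul (-t) (G.inv p))) (s := Metric.ball y₀ 1) Metric.isOpen_ball hk
    (fun p x hp hx => by
      by_contra hne
      refine hx ⟨(_, p), ⟨subset_tsupport _ hne, Metric.ball_subset_closedBall hp⟩, ?_⟩
      simp [G.inv_mul_cancel_right]) hw.locallyIntegrable
    (hφ.comp (G.contDiff_mul_comp contDiff_snd.neg
      (G.contDiff_inv.comp contDiff_fst))).contDiffOn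
  have h2 := (h.contDiffAt (x := (y₀, 0)) ((Metric.isOpen_ball.prod isOpen_univ).mem_nhds
    ⟨Metric.mem_ball_self one_pos, mem_univ _⟩)).comp y₀
    (f := fun y => (y, (0 : Fin n → ℝ))) (contDiffAt_id.prodMk contDiffAt_const)
  simpa [Function.comp_def, convolution] using h2

lemma hasDerivAt_comp_mul_inv_single {h : (Fin n → ℝ) → ℝ} {x : Fin n → ℝ}
    (hh : DifferentiableAt ℝ h x) (j : Fin n) :
    HasDerivAt (fun t : ℝ => h (G.mul x (G.inv (Pi.single j t)))) (-fderiv ℝ h x (G.X j x)) 0 := by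
  have h1 : HasDerivAt (fun t : ℝ => (Pi.single j t : Fin n → ℝ)) (Pi.single j 1) 0 := by
    simpa using (ContinuousLinearMap.single ℝ (fun _ : Fin n => ℝ) j).hasDerivAt (x := 0)
  have h0 : HasFDerivAt G.inv (-ContinuousLinearMap.id ℝ (Fin n → ℝ)) (Pi.single j (0 : ℝ)) := by
    simpa using G.hasFDerivAt_inv_zero
  have h2 : HasFDerivAt (fun y => G.mul x y) (fderiv ℝ (fun y => G.mul x y) 0)
      (G.inv (Pi.single j (0 : ℝ))) := by
    simpa [G.inv_zero] using ((G.differentiable_mul_left x) 0).hasFDerivAt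
  have h3 := h2.comp_hasDerivAt (0 : ℝ) (h0.comp_hasDerivAt (0 : ℝ) h1)
  have h4 : HasFDerivAt h (fderiv ℝ h x) (G.mul x (G.inv (Pi.single j (0 : ℝ)))) := by
    simpa [G.mul_zero, G.inv_zero] using hh.hasFDerivAt
  have h5 := h4.comp_hasDerivAt (0 : ℝ) h3
  simpa [HomogeneousLieGroup.X, Function.comp_def] using h5

/-- A function annihilated by the horizontal fields is annihilated by their iterated brackets. -/
lemma fderiv_isIteratedBracket_eq_zero {g : (Fin n → ℝ) → ℝ} (hg : ContDiff ℝ ∞ g)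
    (hX : ∀ (j : G.Hor) y, fderiv ℝ g y (G.X j y) = 0) {V : (Fin n → ℝ) → (Fin n → ℝ)}
    (hV : G.IsIteratedBracket V) : ContDiff ℝ ∞ V ∧ ∀ y, fderiv ℝ g y (V y) = 0 := by
  induction hV with
  | base j => exact ⟨G.contDiff_X j, hX j⟩
  | @bracket V W _ _ hV hW =>
    obtain ⟨hVs, hV⟩ := hV
    obtain ⟨hWs, hW⟩ := hW
    have hd : ∀ {Y : (Fin n → ℝ) → (Fin n → ℝ)}, ContDiff ℝ ∞ Y → ContDiff ℝ ∞ (fderiv ℝ Y) :=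
      fun hY => hY.fderiv_right (by simp)
    have hg1 : ContDiff ℝ ∞ (fderiv ℝ g) := hg.fderiv_right (by simp)
    refine ⟨((hd hWs).clm_apply hVs).sub ((hd hVs).clm_apply hWs), fun y => ?_⟩
    -- Differentiating dg(Y) = 0 gives D²g(v, Y) + dg(DY v) = 0. Using it for both orders of V and
    -- W, symmetry of D²g leaves dg([V, W]) = 0.
    have key : ∀ {Y : (Fin n → ℝ) → (Fin n → ℝ)}, ContDiff ℝ ∞ Y → (∀ y, fderiv ℝ g y (Y y) = 0) →
        ∀ v, fderiv ℝ (fderiv ℝ g) y v (Y y) + fderiv ℝ g y (fderiv ℝ Y y v) = 0 := by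
      intro Y hYs hY v
      have h1 := ((hg1.differentiable (by simp)) y).hasFDerivAt.clm_apply
        ((hYs.differentiable (by simp)) y).hasFDerivAt
      simp only [hY] at h1
      have := DFunLike.congr_fun (h1.unique (hasFDerivAt_const 0 y)) v
      simp at this
      linarith
    have hs : IsSymmSndFDerivAt ℝ g y := hg.contDiffAt.isSymmSndFDerivAt (by
      simp only [minSmoothness_of_isRCLikeNormedField]; norm_cast)
    have e1 := key hVs hV (W y)
    have e2 := key hWs hW (V y)
    have e3 := hs.eq (V y) (W y)
    rw [VectorField.lieBracket, map_sub]
    linarith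

/-- A continuous function whose weak horizontal derivatives vanish is constant. -/
lemma eq_of_weak_derivative_eq_zero (hr : G.IsHomogeneousNorm r) {w : (Fin n → ℝ) → ℝ}
    (hw : Continuous w)
    (hX : ∀ (j : G.Hor) (φ : (Fin n → ℝ) → ℝ), ContDiff ℝ ∞ φ → HasCompactSupport φ →
      ∫ x, w x * fderiv ℝ φ x (G.X j x) = 0) (y : Fin n → ℝ) : w y = w 0 := by
  have key : ∀ φ : (Fin n → ℝ) → ℝ, ContDiff ℝ ∞ φ → HasCompactSupport φ →
      ∫ x, w (G.mul x y) * φ x = ∫ x, w x * φ x := by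
    intro φ hφ hc
    set g : (Fin n → ℝ) → ℝ := fun y => ∫ x, w (G.mul x y) * φ x with hg
    have hgs : ContDiff ℝ ∞ g := contDiff_integral_mul_right hw hφ hc
    -- X_j g(y) is the limit of the quotients of w tested against φ(· ∘ y⁻¹), and that limit
    -- vanishes by hypothesis.
    have hgX : ∀ (j : G.Hor) y, fderiv ℝ g y (G.X j y) = 0 := by
      intro j y
      set φy : (Fin n → ℝ) → ℝ := fun x => φ (G.mul x (G.inv y)) with hφy
      have hφys : ContDiff ℝ ∞ φy := hφ.comp (G.contDiff_mul_comp contDiff_id contDiff_const)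
      have hφyc : HasCompactSupport φy := by
        refine HasCompactSupport.intro (K := (fun x => G.mul x y) '' tsupport φ)
          (hc.image (G.continuous_mul_comp continuous_id continuous_const)) fun x hx => ?_
        by_contra hne
        exact hx ⟨_, subset_tsupport _ hne, G.inv_mul_cancel_right _ _⟩
      have h1 := tendsto_integral_diffQuot hr hw hφys hφyc j
      rw [hX j φy hφys hφyc, neg_zero] at h1
      have h2 := (hasDerivAt_comp_mul_inv_single (G := G) (hgs.differentiable (by simp) y)
        (j : Fin n)).tendsto_slope_zero_right
      simp only [zero_add, Pi.single_zero, G.inv_zero, G.mul_zero, smul_eq_mul] at h2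
      have h3 : ∀ t : ℝ, ∫ x, G.diffQuot j w t x * φy x =
          -(t⁻¹ * (g (G.mul y (G.inv (Pi.single (j : Fin n) t))) - g y)) := by
        intro t
        have i1 : ∀ z, Integrable fun x => w (G.mul x z) * φ x := fun z =>
          ((hw.comp (G.continuous_mul_comp continuous_id continuous_const)).mul
            hφ.continuous).integrable_of_hasCompactSupport hc.mul_left
        rw [← G.integral_mul_right (fun x => G.diffQuot j w t x * φy x) y, hg]
        simp only
        rw [← integral_sub (i1 _) (i1 y), ← integral_const_mul, ← integral_neg]
        congr 1
        ext x
        simp only [diffQuot, hφy, G.mul_inv_cancel_right, G.mul_assoc]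
        ring
      simp only [h3] at h1
      have := tendsto_nhds_unique h1 h2.neg
      linarith
    have hg0 : ∀ y, fderiv ℝ g y = 0 := by
      intro y
      have hle : Submodule.span ℝ {v | ∃ V, G.IsIteratedBracket V ∧ v = V y} ≤
          LinearMap.ker (fderiv ℝ g y).toLinearMap := by
        rw [Submodule.span_le]
        rintro v ⟨V, hV, rfl⟩
        exact (fderiv_isIteratedBracket_eq_zero hgs hgX hV).2 y
      rw [G.generated y] at hle
      ext1 v
      exact hle (Submodule.mem_top (x := v))
    have := is_const_of_fderiv_eq_zero (hgs.differentiable (by simp)) hg0 y 0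
    simpa [hg, G.mul_zero] using this
  have hwy : Continuous fun x => w (G.mul x y) :=
    hw.comp (G.continuous_mul_comp continuous_id continuous_const)
  have hae : ∀ᵐ x, w (G.mul x y) - w x = 0 := by
    refine ae_eq_zero_of_integral_contDiff_smul_eq_zero (hwy.sub hw).locallyIntegrable
      fun φ hφ hc => ?_
    have i1 : Integrable fun x => w (G.mul x y) * φ x :=
      (hwy.mul hφ.continuous).integrable_of_hasCompactSupport hc.mul_left
    have i2 : Integrable fun x => w x * φ x :=
      (hw.mul hφ.continuous).integrable_of_hasCompactSupport hc.mul_left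
    have := key φ hφ hc
    rw [← sub_eq_zero, ← integral_sub i1 i2] at this
    rw [← this]
    congr 1
    ext x
    simp; ring
  have := ((hwy.sub hw).ae_eq_iff_eq volume continuous_const).1 hae
  have := congrFun this 0
  simp only [Pi.sub_apply, G.zero_mul] at this
  linarith

end HomogeneousCarnotGroup

end

/-! ### The absorption inequality and cut-off functions. -/

section

open scoped ContDiff Topology
open Filter

/-- Interpolation between the two absorbing terms. -/
lemma rpow_mul_rpow_le_of_lt {χ θ μ R s W t K c : ℝ} (hχ1 : χ ≤ 1) (hR0 : 0 < R) (hs : 0 < s)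
    (hW0 : 0 < W) (ht : 0 < t) (hK : 0 < K) (hc : 0 < c) (h1 : t < K * W / (R * s))
    (h2 : c * R ^ (-μ) * W ^ θ * t ^ χ * s * R < K * t) :
    W ^ (θ - (1 - χ)) * s ^ (2 - χ) * R ^ (2 - χ - μ) ≤ K ^ (2 - χ) / c := by
  -- Dividing by t^χ yields a lower bound for t^(1-χ); the upper bound from `h1` then eliminates t.
  have h3 : c * R ^ (-μ) * W ^ θ * s * R < K * t ^ (1 - χ) := by
    rw [Real.rpow_sub ht, Real.rpow_one, ← mul_div_assoc, lt_div_iff₀ (by positivity)]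
    linarith
  have h4 : t ^ (1 - χ) ≤ (K * W / (R * s)) ^ (1 - χ) :=
    Real.rpow_le_rpow ht.le h1.le (by linarith)
  have e1 : c * R ^ (-μ) * W ^ θ * s * R ≤ K * (K * W / (R * s)) ^ (1 - χ) := by
    refine h3.le.trans (by gcongr)
  rw [Real.div_rpow (by positivity) (by positivity), Real.mul_rpow hK.le hW0.le,
    Real.mul_rpow hR0.le hs.le, ← mul_div_assoc, le_div_iff₀ (by positivity)] at e1
  rw [le_div_iff₀ hc, Real.rpow_sub hW0, show 2 - χ - μ = -μ + 1 + (1 - χ) by ring,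
    Real.rpow_add hR0, Real.rpow_add hR0, Real.rpow_one, show 2 - χ = 1 + (1 - χ) by ring,
    Real.rpow_add hs, Real.rpow_add hK, Real.rpow_one, Real.rpow_one,
    div_mul_eq_mul_div, div_mul_eq_mul_div, div_mul_eq_mul_div, div_le_iff₀ (by positivity)]
  linarith

/-- The elementary inequality that absorbs the cut-off error term. -/
lemma exists_absorption_exponent {χ θ μ : ℝ} (hχ0 : 0 ≤ χ) (hχ1 : χ ≤ 1)
    (hμ : μ < 2 - χ) (hθ : 1 - χ < θ) (N : ℕ) :
    ∃ m : ℕ, m ≠ 0 ∧ ∀ K c : ℝ, 0 < K → 0 < c → ∃ C', 0 ≤ C' ∧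
      ∀ R s v t q : ℝ, 1 ≤ R → 0 ≤ s → s ≤ 1 → 0 ≤ v → 0 < t → t ≤ q →
        K * v ^ 2 * s ^ m * t / (q * R) ≤ v * t ^ 2 * s ^ (m + 1) / q +
          c * R ^ (-μ) * (1 + v) ^ θ * t ^ χ * v ^ 2 * s ^ (m + 1) / q + C' / R ^ N := by
  set κ := θ - (1 - χ) with hκ
  set ε := 2 - χ - μ with hε
  have hκ0 : 0 < κ := by linarith
  have hε0 : 0 < ε := by linarith
  -- The M-th power of the interpolation bound must dominate W² and R^N, so κM ≥ 2 and εM ≥ N. For 0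
  -- ≤ s ≤ 1 the power (2 - χ)M is at least s^(2M), whence m = 2M.
  obtain ⟨M, hM⟩ := exists_nat_ge (max (2 / κ) (max (N / ε) 1))
  have hM1 : 2 ≤ κ * M := by
    have := (le_max_left _ _).trans hM
    rw [div_le_iff₀ hκ0] at this; linarith
  have hM2 : (N : ℝ) ≤ ε * M := by
    have := ((le_max_left _ _).trans (le_max_right _ _)).trans hM
    rw [div_le_iff₀ hε0] at this; linarith
  have hM3 : (1 : ℝ) ≤ M := ((le_max_right _ _).trans (le_max_right _ _)).trans hM
  have hM3' : 1 ≤ M := by exact_mod_cast hM3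
  refine ⟨2 * M, by omega, fun K c hK hc => ⟨K * (K ^ (2 - χ) / c) ^ M, by positivity, ?_⟩⟩
  intro R s v t q hR hs0 hs1 hv ht htq
  have hq : 0 < q := ht.trans_le htq
  have hR0 : 0 < R := by linarith
  set D := K ^ (2 - χ) / c with hD
  have hD0 : 0 < D := by positivity
  have hA : 0 ≤ v * t ^ 2 * s ^ (2 * M + 1) / q := by positivity
  have hB : 0 ≤ c * R ^ (-μ) * (1 + v) ^ θ * t ^ χ * v ^ 2 * s ^ (2 * M + 1) / q := by positivity
  have hE : 0 ≤ K * D ^ M / R ^ N := by positivity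
  rcases hs0.eq_or_lt with rfl | hs
  · rw [zero_pow (by omega : 2 * M ≠ 0)]; simp only [mul_zero, zero_mul, zero_div] at *; linarith
  rcases hv.eq_or_lt with rfl | hv
  · simp only [ne_eq, OfNat.ofNat_ne_zero, not_false_eq_true, zero_pow, mul_zero, zero_mul, zero_div] at *
    linarith
  -- All three terms on the right are nonnegative, so if the inequality fails each is smaller than
  -- Z.
  by_contra! hcon
  set Z := K * v ^ 2 * s ^ (2 * M) * t / (q * R) with hZ
  have hZA : v * t ^ 2 * s ^ (2 * M + 1) / q < Z := by linarith
  have hZB : c * R ^ (-μ) * (1 + v) ^ θ * t ^ χ * v ^ 2 * s ^ (2 * M + 1) / q < Z := by linarith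
  have hZE : K * D ^ M / R ^ N < Z := by linarith
  have hW1 : 1 ≤ 1 + v := by linarith
  set W := 1 + v with hW
  have hW0 : 0 < W := by linarith
  -- the gradient is small compared with `v`
  have h1 : t < K * W / (R * s) := by
    have e1 : v * t ^ 2 * s ^ (2 * M + 1) / q = (v * t * s ^ (2 * M) / (q * R)) * (t * (R * s)) := by
      rw [pow_succ s]; field_simp
    have e2 : Z = (v * t * s ^ (2 * M) / (q * R)) * (K * v) := by rw [hZ]; field_simp
    rw [e1, e2] at hZA
    have := lt_of_mul_lt_mul_left hZA (by positivity)
    rw [lt_div_iff₀ (by positivity)]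
    exact this.trans_le (mul_le_mul_of_nonneg_left (by linarith) hK.le)
  have h2 : c * R ^ (-μ) * W ^ θ * t ^ χ * s * R < K * t := by
    have e1 : c * R ^ (-μ) * W ^ θ * t ^ χ * v ^ 2 * s ^ (2 * M + 1) / q =
      (v ^ 2 * s ^ (2 * M) / (q * R)) * (c * R ^ (-μ) * W ^ θ * t ^ χ * s * R) := by
      rw [pow_succ s]; field_simp
    have e2 : Z = (v ^ 2 * s ^ (2 * M) / (q * R)) * (K * t) := by rw [hZ]; field_simp
    rw [e1, e2] at hZB
    exact lt_of_mul_lt_mul_left hZB (by positivity)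
  have h5 := rpow_mul_rpow_le_of_lt (χ := χ) (θ := θ) (μ := μ) hχ1 hR0 hs hW0 ht hK hc h1 h2
  have h6 : W ^ 2 * s ^ (2 * M) * R ^ N ≤ D ^ M := by
    have e0 := pow_le_pow_left₀ (by positivity) h5 M
    rw [mul_pow, mul_pow, ← Real.rpow_mul_natCast hW0.le, ← Real.rpow_mul_natCast hs.le,
      ← Real.rpow_mul_natCast hR0.le] at e0
    refine le_trans ?_ e0
    have f1 : W ^ 2 ≤ W ^ (κ * M) := by
      rw [← Real.rpow_natCast]
      exact Real.rpow_le_rpow_of_exponent_le hW1 (by simpa using hM1)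
    have f2 : s ^ (2 * M) ≤ s ^ ((2 - χ) * M) := by
      rw [← Real.rpow_natCast]
      refine Real.rpow_le_rpow_of_exponent_ge hs hs1 ?_
      push_cast
      linarith [mul_nonneg hχ0 (zero_le_one.trans hM3)]
    have f3 : R ^ N ≤ R ^ (ε * M) := by
      rw [← Real.rpow_natCast]
      exact Real.rpow_le_rpow_of_exponent_le hR hM2
    gcongr
  have h7 : Z ≤ K * (W ^ 2 * s ^ (2 * M)) := by
    have f1 : t / (q * R) ≤ 1 := by
      rw [div_le_one (by positivity)]
      exact htq.trans (le_mul_of_one_le_right hq.le hR)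
    have f2 : v ^ 2 ≤ W ^ 2 := pow_le_pow_left₀ hv.le (by linarith) 2
    calc Z = K * (v ^ 2 * s ^ (2 * M)) * (t / (q * R)) := by rw [hZ]; ring
      _ ≤ K * (v ^ 2 * s ^ (2 * M)) * 1 := by gcongr
      _ ≤ K * (W ^ 2 * s ^ (2 * M)) := by rw [mul_one]; gcongr
  rw [div_lt_iff₀ (by positivity)] at hZE
  have h8 : Z * R ^ N ≤ K * (W ^ 2 * s ^ (2 * M)) * R ^ N :=
    mul_le_mul_of_nonneg_right h7 (by positivity)
  have h9 := mul_le_mul_of_nonneg_left h6 hK.le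
  linarith

namespace HomogeneousCarnotGroup

variable {n : ℕ} {G : HomogeneousCarnotGroup n} {r : (Fin n → ℝ) → ℝ}

/-- Cut-off functions at scale `R`. -/
lemma exists_cutoff (hr : G.IsHomogeneousNorm r) :
    ∃ (Ψ : ℝ → (Fin n → ℝ) → ℝ) (K M : ℝ) (D : ℕ), 0 < K ∧ 0 ≤ M ∧ ∀ R, 1 ≤ R →
      ContDiff ℝ ∞ (Ψ R) ∧ HasCompactSupport (Ψ R) ∧ (∀ x, 0 ≤ Ψ R x) ∧ (∀ x, Ψ R x ≤ 1) ∧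
      (∀ x, ‖G.horGrad (Ψ R) x‖ ≤ K / R) ∧ (∀ x, Ψ R x ≠ 0 → r x ≤ M * R) ∧
      volume.real (tsupport (Ψ R)) ≤ M * R ^ D ∧ ∀ x, ‖x‖ ≤ R → Ψ R x = 1 := by
  let ψ : ContDiffBump (0 : Fin n → ℝ) := ⟨1, 2, one_pos, one_lt_two⟩
  have hψ : ContDiff ℝ ∞ ψ := ψ.contDiff
  have hψc : HasCompactSupport ψ := ψ.hasCompactSupport
  have hgc : HasCompactSupport (G.horGrad ψ) := by
    refine (hψc.fderiv ℝ).mono fun x hx => ?_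
    contrapose! hx
    rw [Function.notMem_support] at hx ⊢
    ext j
    simp [horGrad, hx]
  obtain ⟨K, hK⟩ := hgc.exists_bound_of_continuous (continuous_horGrad hψ)
  have hK0 : 0 ≤ K := (norm_nonneg _).trans (hK 0)
  obtain ⟨M, hM⟩ := (isCompact_closedBall (0 : Fin n → ℝ) 2).exists_bound_of_continuousOn
    hr.continuous.continuousOn
  set d := Finset.univ.sup G.deg with hd
  -- The support lies in a sup-norm ball of radius 2R^d, d being the largest degree, of volume 4^n
  -- R^(dn). Degree-one homogeneity of X_j gives the factor 1/R in the gradient.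
  refine ⟨fun R x => ψ (G.dilation R⁻¹ x), K + 1, max M (4 ^ n), d * n, by positivity,
    le_max_of_le_right (by positivity), fun R hR => ?_⟩
  have hR0 : 0 < R := by linarith
  have hRi : 0 < R⁻¹ := by positivity
  have hsm : ContDiff ℝ ∞ fun x => ψ (G.dilation R⁻¹ x) := by
    simpa [Function.comp_def, HomogeneousLieGroup.dilationCLM_apply] using
      hψ.comp (G.dilationCLM R⁻¹).contDiff
  have hRR : ∀ x, G.dilation R (G.dilation R⁻¹ x) = x := fun x => by
    rw [G.dilation_dilation, mul_inv_cancel₀ hR0.ne', G.dilation_one]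
  have hball : ∀ x, ψ (G.dilation R⁻¹ x) ≠ 0 → ‖G.dilation R⁻¹ x‖ < 2 := fun x hx => by
    have h1 : G.dilation R⁻¹ x ∈ Function.support ψ := hx
    rw [ψ.support_eq] at h1
    simpa [ψ] using h1
  have hsub : tsupport (fun x => ψ (G.dilation R⁻¹ x)) ⊆ Metric.closedBall 0 (2 * R ^ d) := by
    refine closure_minimal (fun x hx => ?_) Metric.isClosed_closedBall
    have h1 := hball x hx
    rw [mem_closedBall_zero_iff]
    refine (pi_norm_le_iff_of_nonneg (by positivity)).2 fun i => ?_
    have h2 : ‖G.dilation R⁻¹ x i‖ < 2 := (norm_le_pi_norm _ i).trans_lt h1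
    rw [← hRR x]
    simp only [HomogeneousLieGroup.dilation] at h2 ⊢
    rw [norm_mul, mul_comm, norm_pow, Real.norm_of_nonneg hR0.le]
    have h3 : R ^ G.deg i ≤ R ^ d := pow_le_pow_right₀ hR (Finset.le_sup (Finset.mem_univ i))
    gcongr
  refine ⟨hsm, (isCompact_closedBall _ _).of_isClosed_subset (isClosed_tsupport _) hsub,
    fun x => ψ.nonneg, fun x => ψ.le_one, fun x => ?_, fun x hx => ?_, ?_, fun x hx => ?_⟩
  · have e : G.horGrad (fun x => ψ (G.dilation R⁻¹ x)) x =
        R⁻¹ • G.horGrad ψ (G.dilation R⁻¹ x) := by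
      ext j
      simp only [horGrad, PiLp.smul_apply, smul_eq_mul]
      exact G.fderiv_comp_dilation_X (hψ.differentiable (by simp)) j hRi x
    rw [e, norm_smul, Real.norm_of_nonneg hRi.le, div_eq_inv_mul]
    gcongr
    linarith [hK (G.dilation R⁻¹ x)]
  · have h1 := hM (G.dilation R⁻¹ x) (by simpa using (hball x hx).le)
    rw [← hRR x, hr.dilation R hR0, mul_comm]
    gcongr
    exact (le_abs_self _).trans (h1.trans (le_max_left _ _))
  · calc volume.real (tsupport fun x => ψ (G.dilation R⁻¹ x))
        ≤ volume.real (Metric.closedBall (0 : Fin n → ℝ) (2 * R ^ d)) :=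
          measureReal_mono hsub (isCompact_closedBall _ _).measure_lt_top.ne
      _ = 4 ^ n * R ^ (d * n) := by
          rw [Measure.real, Real.volume_pi_closedBall _ (by positivity),
            ENNReal.toReal_ofReal (by positivity), Fintype.card_fin, ← mul_assoc, mul_pow,
            pow_mul]
          norm_num
      _ ≤ _ := by gcongr; exact le_max_right _ _
  · refine ψ.one_of_mem_closedBall ?_
    rw [mem_closedBall_zero_iff]
    refine (pi_norm_le_iff_of_nonneg ψ.rIn_pos.le).2 fun i => ?_
    have h1 : ‖x i‖ ≤ R := (norm_le_pi_norm x i).trans hx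
    have h2 : R ≤ R ^ G.deg i := le_self_pow₀ hR (by have := G.deg_pos i; omega)
    simp only [HomogeneousLieGroup.dilation, ψ]
    rw [norm_mul, norm_pow, norm_inv, Real.norm_of_nonneg hR0.le, inv_pow,
      inv_mul_le_iff₀ (by positivity)]
    linarith

end HomogeneousCarnotGroup

end

/-! ### The energy estimate on a super-level set. -/

section

open scoped Topology
open Filter

section TruncatedSquare

/-- Squaring the positive part smooths its corner; this is the quadratic remainder required by the
chain rule. -/
lemma truncSq_sub_le (γ a c : ℝ) :
    |max (c - γ) 0 ^ 2 - max (a - γ) 0 ^ 2 - 2 * max (a - γ) 0 * (c - a)| ≤ 1 * (c - a) ^ 2 := by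
  obtain ⟨x, rfl⟩ : ∃ x, a = x + γ := ⟨a - γ, by ring⟩
  obtain ⟨y, rfl⟩ : ∃ y, c = y + γ := ⟨c - γ, by ring⟩
  simp only [add_sub_cancel_right, add_sub_add_right_eq_sub, one_mul]
  rw [abs_le]
  rcases le_total 0 x with hx | hx <;> rcases le_total 0 y with hy | hy <;>
    simp only [max_eq_left, max_eq_right, hx, hy] <;> constructor
  · nlinarith
  · nlinarith
  · nlinarith [mul_nonneg hx (neg_nonneg.2 hy)]
  · nlinarith [mul_nonneg hx (neg_nonneg.2 hy)]
  · nlinarith [mul_nonneg (neg_nonneg.2 hx) hy]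
  · nlinarith [mul_nonneg (neg_nonneg.2 hx) hy]
  · nlinarith
  · nlinarith

lemma contDiff_truncSq (γ : ℝ) : ContDiff ℝ 1 fun a : ℝ => max (a - γ) 0 ^ 2 := by
  have hd : ∀ a, HasDerivAt (fun a : ℝ => max (a - γ) 0 ^ 2) (2 * max (a - γ) 0) a := by
    intro a
    rw [hasDerivAt_iff_isLittleO]
    refine Asymptotics.IsBigO.trans_isLittleO (g := fun c => (c - a) ^ 2) ?_ ?_
    · refine Asymptotics.IsBigO.of_bound 1 (Eventually.of_forall fun c => ?_)
      have := truncSq_sub_le γ a c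
      rw [smul_eq_mul, Real.norm_eq_abs, Real.norm_of_nonneg (sq_nonneg _), mul_comm (c - a)]
      exact this
    · simpa using Asymptotics.isLittleO_pow_sub_sub a one_lt_two
  rw [contDiff_one_iff_deriv]
  refine ⟨fun a => (hd a).differentiableAt, ?_⟩
  rw [funext fun a => (hd a).deriv]
  fun_prop

end TruncatedSquare

namespace HomogeneousCarnotGroup

variable {n : ℕ} {G : HomogeneousCarnotGroup n} {r : (Fin n → ℝ) → ℝ}

lemma horGrad_pow {Ψ : (Fin n → ℝ) → ℝ} (hΨ : Differentiable ℝ Ψ) (m : ℕ) (x : Fin n → ℝ) :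
    G.horGrad (fun x => Ψ x ^ (m + 1)) x = ((m + 1) * Ψ x ^ m) • G.horGrad Ψ x := by
  ext j
  simp only [horGrad, PiLp.smul_apply]
  rw [fderiv_fun_pow _ (hΨ x)]
  simp

namespace IsWeakGradient

variable {u : (Fin n → ℝ) → ℝ} {U : (Fin n → ℝ) → EuclideanSpace ℝ G.Hor}

/-- U is essentially bounded on the support of k, so H(‖U‖) is too. Precomposing with max t 0 makes
H continuous on the whole line. -/
lemma integrable_mul_comp_norm (hr : G.IsHomogeneousNorm r) (hu : G.LipNear r u)
    (hU : G.IsWeakGradient u U) {k : (Fin n → ℝ) → ℝ} (hk : Continuous k) (hkc : HasCompactSupport k)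
    {H : ℝ → ℝ} (hH : ContinuousOn H (Ici 0)) : Integrable fun x => k x * H ‖U x‖ := by
  have hH' : Continuous fun t => H (max t 0) :=
    hH.comp_continuous (by fun_prop) fun t => mem_Ici.2 (le_max_right _ _)
  have hHU : ∀ x, H ‖U x‖ = H (max ‖U x‖ 0) := fun x => by rw [max_eq_left (norm_nonneg _)]
  have hm : AEStronglyMeasurable (fun x => k x * H ‖U x‖) volume := by
    simp only [hHU]
    exact hk.aestronglyMeasurable.mul
      (hH'.comp_aestronglyMeasurable hU.1.aestronglyMeasurable.norm)
  obtain ⟨L, hL, hLae⟩ := hU.exists_ae_norm_le hr hu (K := tsupport k) hkc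
  obtain ⟨B, hB⟩ := (isCompact_Icc (a := (0 : ℝ)) (b := L)).exists_bound_of_continuousOn
    (hH.mono Icc_subset_Ici_self)
  refine Integrable.mono' ((hk.abs.integrable_of_hasCompactSupport hkc.norm).mul_const B) hm ?_
  filter_upwards [hLae] with x hx
  by_cases hxk : x ∈ tsupport k
  · rw [norm_mul, Real.norm_eq_abs]
    exact mul_le_mul_of_nonneg_left (hB _ ⟨norm_nonneg _, hx hxk⟩) (abs_nonneg _)
  · simp [image_eq_zero_of_notMem_tsupport hxk]

/-- Integrability of the flux term. -/
lemma integrable_flux (hr : G.IsHomogeneousNorm r) (hu : G.LipNear r u)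
    (hU : G.IsWeakGradient u U) {k₁ k₂ : (Fin n → ℝ) → ℝ} (hk₁ : Continuous k₁)
    (hk₁c : HasCompactSupport k₁) (hk₂ : Continuous k₂) (hk₂c : HasCompactSupport k₂)
    {Y : (Fin n → ℝ) → EuclideanSpace ℝ G.Hor} (hY : Continuous Y) {B : ℝ} (hB : ∀ x, ‖Y x‖ ≤ B) :
    Integrable fun x => (k₁ x * ‖U x‖ ^ 2 + k₂ x * inner ℝ (U x) (Y x)) / √(1 + ‖U x‖ ^ 2) := by
  have hq0 : ∀ t : ℝ, √(1 + t ^ 2) ≠ 0 := fun t => (Real.sqrt_pos.2 (by positivity)).ne'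
  have hqc : Continuous fun t : ℝ => √(1 + t ^ 2) := by fun_prop
  have i1 := hU.integrable_mul_comp_norm hr hu hk₁ hk₁c (H := fun t => t ^ 2 / √(1 + t ^ 2))
    ((continuous_id.pow 2).div hqc hq0).continuousOn
  have i2 := hU.integrable_mul_comp_norm hr hu hk₂ hk₂c (H := fun t => t / √(1 + t ^ 2))
    (continuous_id.div hqc hq0).continuousOn
  have hUm := hU.1.aestronglyMeasurable
  have i3 : Integrable fun x => k₂ x * inner ℝ (U x) (Y x) / √(1 + ‖U x‖ ^ 2) := by
    refine Integrable.mono' (i2.norm.mul_const B) ?_ (Eventually.of_forall fun x => ?_)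
    · exact ((hk₂.aestronglyMeasurable.mul (hUm.inner hY.aestronglyMeasurable)).aemeasurable.div
        (hqc.comp_aestronglyMeasurable hUm.norm).aemeasurable).aestronglyMeasurable
    · have hin : |inner ℝ (U x) (Y x)| ≤ ‖U x‖ * B :=
        (abs_real_inner_le_norm _ _).trans (mul_le_mul_of_nonneg_left (hB x) (norm_nonneg _))
      rw [norm_div, norm_mul, norm_mul, norm_div, norm_norm, mul_div_assoc, mul_assoc, div_mul_eq_mul_div]
      rw [Real.norm_eq_abs (inner ℝ (U x) (Y x))]
      gcongr
  refine (i1.add i3).congr (Eventually.of_forall fun x => ?_)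
  simp only [Pi.add_apply]
  ring

end IsWeakGradient

/-- It replaces the denominator 1 + t of the bound on l by the denominator q of the flux. -/
lemma one_add_le_two_mul_sqrt (t : ℝ) : 1 + t ≤ 2 * √(1 + t ^ 2) := by
  have h1 : 1 ≤ √(1 + t ^ 2) := Real.one_le_sqrt.2 (by nlinarith)
  have h2 : t ≤ √(1 + t ^ 2) := Real.le_sqrt_of_sq_le (by linarith)
  linarith

/-- Of the two copies of the gradient term, one helps absorb the cut-off error and the other
survives. At t = 0 only J ≥ 0 is needed; at s = 0 the error vanishes because m ≠ 0. -/
lemma flux_add_source_ge {m : ℕ} (hm : m ≠ 0) {v s t q J i K R B E : ℝ} (hv : 0 ≤ v) (hs : 0 ≤ s)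
    (ht : 0 ≤ t) (hq : 0 < q) (hi : |i| ≤ t * (K / R)) (hR : 0 < R)
    (hJ0 : 0 < v → 0 ≤ J) (hJ : 0 < v → 0 < t → 0 < s → B / q ≤ J) (hE : 0 ≤ E)
    (hpt : 0 < t → (m + 1) * K * v ^ 2 * s ^ m * t / (q * R) ≤ v * t ^ 2 * s ^ (m + 1) / q +
      B * v ^ 2 * s ^ (m + 1) / q + E) :
    v * s ^ (m + 1) * (t ^ 2 / q) - E ≤
      (2 * v * s ^ (m + 1) * t ^ 2 + v ^ 2 * ((m + 1) * s ^ m) * i) / q +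
        J * (v ^ 2 * s ^ (m + 1)) := by
  rcases hv.eq_or_lt with rfl | hv
  · simpa using hE
  rcases hs.eq_or_lt with rfl | hs
  · simpa [hm] using hE
  rcases ht.eq_or_lt with rfl | ht
  · have : i = 0 := by simpa using hi
    subst this
    have := mul_nonneg (hJ0 hv) (show 0 ≤ v ^ 2 * s ^ (m + 1) by positivity)
    simp
    linarith
  have h1 : B / q * (v ^ 2 * s ^ (m + 1)) ≤ J * (v ^ 2 * s ^ (m + 1)) :=
    mul_le_mul_of_nonneg_right (hJ hv ht hs) (by positivity)
  have h2 : -((m + 1) * K * v ^ 2 * s ^ m * t / (q * R)) ≤ v ^ 2 * ((m + 1) * s ^ m) * i / q := by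
    have e : (m + 1) * K * v ^ 2 * s ^ m * t / (q * R) =
        v ^ 2 * ((m + 1) * s ^ m) / q * (t * (K / R)) := by field_simp
    have h := mul_le_mul_of_nonneg_left (neg_le_of_abs_le hi)
      (show 0 ≤ v ^ 2 * ((m + 1) * s ^ m) / q by positivity)
    rw [e, mul_div_right_comm (v ^ 2 * ((m + 1) * s ^ m)) i q, ← mul_neg]
    exact h
  have h3 := hpt ht
  have e1 : v * s ^ (m + 1) * (t ^ 2 / q) = v * t ^ 2 * s ^ (m + 1) / q := by ring
  have e2 : (2 * v * s ^ (m + 1) * t ^ 2 + v ^ 2 * ((m + 1) * s ^ m) * i) / q =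
      2 * (v * t ^ 2 * s ^ (m + 1) / q) + v ^ 2 * ((m + 1) * s ^ m) * i / q := by ring
  have e3 : B / q * (v ^ 2 * s ^ (m + 1)) = B * v ^ 2 * s ^ (m + 1) / q := by ring
  rw [e1, e2]
  linarith

/-- Lower bound for the right-hand side on the support of a cut-off function at scale `R`. -/
lemma source_ge {μ χ θ C c M R ρ β y w t z : ℝ} (hμ0 : 0 ≤ μ) (hC : 0 < C) (hc : 0 < c)
    (hM : 0 ≤ M) (hR : 1 ≤ R) (hρ0 : 0 ≤ ρ) (hρ : ρ ≤ M * R) (hw : 0 ≤ w) (ht : 0 < t)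
    (hβ : C * (1 + ρ) ^ (-μ) ≤ β) (hy : c * (1 + w) ^ θ ≤ y) (hz : C * (t ^ χ / (1 + t)) ≤ z) :
    C ^ 2 * c * (1 + M) ^ (-μ) / 2 * R ^ (-μ) * (1 + w) ^ θ * t ^ χ / √(1 + t ^ 2) ≤ β * y * z := by
  have hR0 : 0 < R := by linarith
  have hq : 0 < √(1 + t ^ 2) := Real.sqrt_pos.2 (by positivity)
  have h1 : (1 + M) ^ (-μ) * R ^ (-μ) ≤ (1 + ρ) ^ (-μ) := by
    rw [← Real.mul_rpow (by positivity) hR0.le]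
    exact Real.rpow_le_rpow_of_nonpos (by positivity) (by nlinarith) (by linarith)
  have h2 : t ^ χ / (2 * √(1 + t ^ 2)) ≤ t ^ χ / (1 + t) := by
    gcongr
    exact one_add_le_two_mul_sqrt t
  calc C ^ 2 * c * (1 + M) ^ (-μ) / 2 * R ^ (-μ) * (1 + w) ^ θ * t ^ χ / √(1 + t ^ 2)
      = C * ((1 + M) ^ (-μ) * R ^ (-μ)) * (c * (1 + w) ^ θ) *
        (C * (t ^ χ / (2 * √(1 + t ^ 2)))) := by field_simp
    _ ≤ C * (1 + ρ) ^ (-μ) * (c * (1 + w) ^ θ) * (C * (t ^ χ / (1 + t))) := by gcongr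
    _ ≤ β * y * z := by
      have hβ0 : 0 ≤ β := le_trans (by positivity) hβ
      have hy0 : 0 ≤ y := le_trans (by positivity) hy
      gcongr

/-- The Caccioppoli-type estimate on the super-level set `{u > γ}`. -/
lemma IsMeanCurvatureSubsolution.exists_energy_bound (hr : G.IsHomogeneousNorm r)
    {μ χ θ : ℝ} (hχ0 : 0 ≤ χ) (hχ1 : χ ≤ 1) (hμ0 : 0 ≤ μ) (hμ : μ < 2 - χ) (hθ : 1 - χ < θ)
    {b : (Fin n → ℝ) → ℝ} (hb : Continuous b) {f l : ℝ → ℝ} (hf : Continuous f)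
    (hl : ContinuousOn l (Ici 0)) (hl0 : 0 ≤ l 0) {C : ℝ} (hC : 0 < C)
    (hbC : ∀ x, C * (1 + r x) ^ (-μ) ≤ b x) (hlC : ∀ t, 0 < t → C * (t ^ χ / (1 + t)) ≤ l t)
    {u : (Fin n → ℝ) → ℝ} (hu : G.LipNear r u) {U : (Fin n → ℝ) → EuclideanSpace ℝ G.Hor}
    (hU : G.IsWeakGradient u U)
    (hsub : ∀ φ Φ, G.IsLipC r φ → (∀ x, 0 ≤ φ x) → G.IsWeakGradient φ Φ →
      ∫ x, inner ℝ (U x) (Φ x) / √(1 + ‖U x‖ ^ 2) ≤ - ∫ x, b x * f (u x) * l ‖U x‖ * φ x)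
    {γ c : ℝ} (hc : 0 < c) (hfγ : ∀ x, γ < u x → c * (1 + (u x - γ)) ^ θ ≤ f (u x)) :
    ∃ C', ∀ R, 1 ≤ R →
      IntegrableOn (fun x => max (u x - γ) 0 * (‖U x‖ ^ 2 / √(1 + ‖U x‖ ^ 2)))
        (Metric.closedBall 0 R) ∧
      ∫ x in Metric.closedBall 0 R, max (u x - γ) 0 * (‖U x‖ ^ 2 / √(1 + ‖U x‖ ^ 2)) ≤ C' / R := by
  obtain ⟨Ψ, K₀, M, D, hK₀, hM, hΨ⟩ := exists_cutoff hr
  -- N = D + 1 beats the volume R^D of the support by one power of R.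
  obtain ⟨m, hm0, hm⟩ := exists_absorption_exponent hχ0 hχ1 hμ hθ (D + 1)
  obtain ⟨C', hC', hpt⟩ := hm ((m + 1) * K₀) (C ^ 2 * c * (1 + M) ^ (-μ) / 2) (by positivity)
    (by positivity)
  have huc := hu.continuous hr
  have hvc : Continuous fun x => max (u x - γ) 0 := (huc.sub continuous_const).max continuous_const
  refine ⟨C' * M, fun R hR => ?_⟩
  have hR0 : 0 < R := by linarith
  obtain ⟨hs, hsc, hs0, hs1, hsg, hsr, hsv, hsone⟩ := hΨ R hR
  set s := Ψ R
  have hscont := hs.continuous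
  have hTc : IsCompact (tsupport s) := hsc
  have hpow : ContDiff ℝ (⊤ : ℕ∞) fun x => s x ^ (m + 1) := hs.pow _
  have hpowc : HasCompactSupport fun x => s x ^ (m + 1) :=
    hsc.comp_left (g := fun a : ℝ => a ^ (m + 1)) (by simp)
  have hv2 : G.LipNear r fun x => max (u x - γ) 0 ^ 2 := hu.comp hr (contDiff_truncSq γ)
  have hφL : G.LipNear r fun x => max (u x - γ) 0 ^ 2 * s x ^ (m + 1) :=
    hv2.mul hr (LipNear.of_contDiff hr hpow)
  have hφc : HasCompactSupport fun x => max (u x - γ) 0 ^ 2 * s x ^ (m + 1) := hpowc.mul_left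
  have hV := (hU.comp hr hu (F := fun a => max (a - γ) 0 ^ 2) (F' := fun a => 2 * max (a - γ) 0)
    (by fun_prop) (by fun_prop) (truncSq_sub_le γ)).mul_contDiff (hv2.continuous hr) hpow
  have hmain := hsub _ _ ⟨hφL.isLipOn_univ hr hφc, hφc⟩
    (fun x => mul_nonneg (sq_nonneg _) (pow_nonneg (hs0 x) _)) hV
  simp only [horGrad_pow (hs.differentiable (by simp))] at hmain
  set q : (Fin n → ℝ) → ℝ := fun x => √(1 + ‖U x‖ ^ 2) with hq
  have hq0 : ∀ x, 0 < q x := fun x => Real.sqrt_pos.2 (by positivity)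
  have htq : ∀ x, ‖U x‖ ≤ q x := fun x => Real.le_sqrt_of_sq_le (by linarith)
  have hinner : ∀ x, inner ℝ (U x) (s x ^ (m + 1) • (2 * max (u x - γ) 0) • U x +
      max (u x - γ) 0 ^ 2 • ((m + 1) * s x ^ m) • G.horGrad s x) =
      2 * max (u x - γ) 0 * s x ^ (m + 1) * ‖U x‖ ^ 2 +
        max (u x - γ) 0 ^ 2 * ((m + 1) * s x ^ m) * inner ℝ (U x) (G.horGrad s x) := by
    intro x
    simp only [inner_add_right, inner_smul_right, real_inner_self_eq_norm_sq]
    ring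
  have hcs : ∀ x, |inner ℝ (U x) (G.horGrad s x)| ≤ ‖U x‖ * (K₀ / R) := fun x =>
    (abs_real_inner_le_norm _ _).trans (mul_le_mul_of_nonneg_left (hsg x) (norm_nonneg _))
  simp only [hinner] at hmain
  have hH2 : ContinuousOn (fun t : ℝ => t ^ 2 / √(1 + t ^ 2)) (Ici 0) :=
    (Continuous.div (by fun_prop) (by fun_prop)
      fun t => (Real.sqrt_pos.2 (by positivity)).ne').continuousOn
  have iA : Integrable fun x => max (u x - γ) 0 * s x ^ (m + 1) * (‖U x‖ ^ 2 / q x) :=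
    hU.integrable_mul_comp_norm hr hu (hvc.mul (hscont.pow _)) hpowc.mul_left hH2
  have iJ : Integrable fun x => b x * f (u x) * l ‖U x‖ * (max (u x - γ) 0 ^ 2 * s x ^ (m + 1)) := by
    have := hU.integrable_mul_comp_norm hr hu
      ((hb.mul (hf.comp huc)).mul (hφL.continuous hr)) hφc.mul_left hl
    refine this.congr (Eventually.of_forall fun x => ?_)
    simp only [Function.comp_apply, Pi.mul_apply]; ring
  have hmc : HasCompactSupport fun x => (m + 1) * s x ^ m :=
    hsc.comp_left (g := fun a : ℝ => (m + 1) * a ^ m) (by simp [hm0])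
  have hk₁ : Continuous fun x => 2 * max (u x - γ) 0 * s x ^ (m + 1) := by fun_prop
  have hk₁c : HasCompactSupport fun x => 2 * max (u x - γ) 0 * s x ^ (m + 1) := hpowc.mul_left
  have hk₂ : Continuous fun x => max (u x - γ) 0 ^ 2 * ((m + 1) * s x ^ m) := by fun_prop
  have hk₂c : HasCompactSupport fun x => max (u x - γ) 0 ^ 2 * ((m + 1) * s x ^ m) := hmc.mul_left
  have iI := hU.integrable_flux hr hu hk₁ hk₁c hk₂ hk₂c (continuous_horGrad hs) hsg
  have hpoint : ∀ x, max (u x - γ) 0 * s x ^ (m + 1) * (‖U x‖ ^ 2 / q x) -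
      (tsupport s).indicator (fun _ => C' / R ^ (D + 1)) x ≤
      (2 * max (u x - γ) 0 * s x ^ (m + 1) * ‖U x‖ ^ 2 +
        max (u x - γ) 0 ^ 2 * ((m + 1) * s x ^ m) * inner ℝ (U x) (G.horGrad s x)) / q x +
      b x * f (u x) * l ‖U x‖ * (max (u x - γ) 0 ^ 2 * s x ^ (m + 1)) := by
    intro x
    by_cases hx : x ∈ tsupport s
    · rw [indicator_of_mem hx]
      have hvpos : 0 < max (u x - γ) 0 → max (u x - γ) 0 = u x - γ ∧ γ < u x := fun h => by
        rcases lt_max_iff.1 h with h | h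
        · exact ⟨max_eq_left h.le, by linarith⟩
        · exact absurd h (lt_irrefl _)
      refine flux_add_source_ge (v := max (u x - γ) 0) (s := s x) (t := ‖U x‖) (q := q x)
        (J := b x * f (u x) * l ‖U x‖) (i := inner ℝ (U x) (G.horGrad s x)) (K := K₀) (R := R)
        (B := C ^ 2 * c * (1 + M) ^ (-μ) / 2 * R ^ (-μ) * (1 + max (u x - γ) 0) ^ θ * ‖U x‖ ^ χ)
        (E := C' / R ^ (D + 1)) hm0 (le_max_right _ _) (hs0 x) (norm_nonneg _) (hq0 x) (hcs x) hR0
        (fun hv => ?_) (fun hv ht hsx => ?_) (by positivity)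
        (fun ht => hpt R (s x) (max (u x - γ) 0) ‖U x‖ (q x) hR (hs0 x) (hs1 x) (le_max_right _ _) ht (htq x))
      · obtain ⟨hv1, hv2⟩ := hvpos hv
        have hf0 : 0 ≤ f (u x) :=
          le_trans (mul_nonneg hc.le (Real.rpow_nonneg (by linarith) _)) (hfγ x hv2)
        have hb0 : 0 ≤ b x :=
          le_trans (mul_nonneg hC.le (Real.rpow_nonneg (by linarith [hr.nonneg x]) _)) (hbC x)
        have hl0 : 0 ≤ l ‖U x‖ := by
          rcases (norm_nonneg (U x)).eq_or_lt with h | h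
          · rwa [← h]
          · exact le_trans (by positivity) (hlC _ h)
        positivity
      · obtain ⟨hv1, hv2⟩ := hvpos hv
        rw [hv1]
        exact source_ge hμ0 hC hc hM hR (hr.nonneg x) (hsr x hsx.ne') (by linarith) ht (hbC x)
          (hfγ x hv2) (hlC _ ht)
    · simp [indicator_of_notMem hx, image_eq_zero_of_notMem_tsupport hx, hm0]
  have iE : Integrable ((tsupport s).indicator fun _ => C' / R ^ (D + 1)) :=
    (integrable_indicator_iff hTc.measurableSet).2 (integrableOn_const hTc.measure_lt_top.ne)
  -- By `hmain` the integral of flux plus source is nonpositive, so only the remainder integrated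
  -- over the support is left.
  have hint := integral_mono (iA.sub iE) (iI.add iJ) hpoint
  rw [integral_sub' iA iE, integral_add' iI iJ, integral_indicator hTc.measurableSet,
    setIntegral_const, smul_eq_mul] at hint
  have hE : volume.real (tsupport s) * (C' / R ^ (D + 1)) ≤ C' * M / R := by
    calc volume.real (tsupport s) * (C' / R ^ (D + 1)) ≤ M * R ^ D * (C' / R ^ (D + 1)) := by gcongr
      _ = C' * M / R := by rw [pow_succ]; field_simp
  have hcongr : EqOn (fun x => max (u x - γ) 0 * s x ^ (m + 1) * (‖U x‖ ^ 2 / q x))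
      (fun x => max (u x - γ) 0 * (‖U x‖ ^ 2 / q x)) (Metric.closedBall 0 R) := fun x hx => by
    simp [hsone x (mem_closedBall_zero_iff.1 hx)]
  have hball : MeasurableSet (Metric.closedBall (0 : Fin n → ℝ) R) :=
    Metric.isClosed_closedBall.measurableSet
  refine ⟨iA.integrableOn.congr_fun hcongr hball, ?_⟩
  have hA : ∫ x in Metric.closedBall 0 R, max (u x - γ) 0 * (‖U x‖ ^ 2 / q x) ≤
      ∫ x, max (u x - γ) 0 * s x ^ (m + 1) * (‖U x‖ ^ 2 / q x) := by
    rw [← setIntegral_congr_fun hball hcongr]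
    refine setIntegral_le_integral iA (Eventually.of_forall fun x => ?_)
    have h1 : 0 ≤ max (u x - γ) 0 := le_max_right _ _
    have h2 := hs0 x
    have h3 := hq0 x
    show (0 : ℝ) ≤ max (u x - γ) 0 * s x ^ (m + 1) * (‖U x‖ ^ 2 / q x)
    positivity
  linarith

end HomogeneousCarnotGroup

end

/-! ### The dichotomy for levels and the conclusion. -/

section

open scoped Topology
open Filter

namespace HomogeneousCarnotGroup

variable {n : ℕ} {G : HomogeneousCarnotGroup n} {r : (Fin n → ℝ) → ℝ}

/-- A subsolution lies below every level above which `f` grows superlinearly enough, unless it is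
constant. -/
lemma IsMeanCurvatureSubsolution.le_or_const (hr : G.IsHomogeneousNorm r)
    {μ χ θ : ℝ} (hχ0 : 0 ≤ χ) (hχ1 : χ ≤ 1) (hμ : μ < 2 - χ) (hθ : 1 - χ < θ)
    {b : (Fin n → ℝ) → ℝ} (hb : Continuous b) {f l : ℝ → ℝ} (hf : Continuous f)
    (hl : ContinuousOn l (Ici 0)) (hlpos : ∀ t, 0 < t → 0 < l t) {C : ℝ} (hC : 0 < C)
    (hbC : ∀ x, C * (1 + r x) ^ (-μ) ≤ b x) (hlC : ∀ t, 0 < t → C * (t ^ χ / (1 + t)) ≤ l t)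
    {u : (Fin n → ℝ) → ℝ} (hu : G.IsMeanCurvatureSubsolution r b f l u)
    {γ c : ℝ} (hc : 0 < c) (hfγ : ∀ x, γ < u x → c * (1 + (u x - γ)) ^ θ ≤ f (u x)) :
    (∀ x, u x ≤ γ) ∨ ∃ c, ∀ x, u x = c := by
  obtain ⟨hLip, U, hU, hsub⟩ := hu
  have hu := hLip.lipNear hr
  have huc := hu.continuous hr
  have hl0 : 0 ≤ l 0 := by
    have h1 : Tendsto l (𝓝[>] 0) (𝓝 (l 0)) :=
      (hl 0 self_mem_Ici).mono_left (nhdsWithin_mono _ Ioi_subset_Ici_self)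
    exact ge_of_tendsto h1 (eventually_nhdsWithin_of_forall fun t ht => (hlpos t ht).le)
  -- Since 1 + r ≥ 1, raising μ to max μ 0 only weakens the bound, and the new exponent stays below
  -- 2 - χ as χ ≤ 1. A nonnegative exponent lets r ≤ MR bound b from below.
  have hbC' : ∀ x, C * (1 + r x) ^ (-max μ 0) ≤ b x := fun x => by
    refine le_trans (mul_le_mul_of_nonneg_left ?_ hC.le) (hbC x)
    exact Real.rpow_le_rpow_of_exponent_le (by linarith [hr.nonneg x])
      (neg_le_neg (le_max_left _ _))
  obtain ⟨C', hE⟩ := exists_energy_bound hr hχ0 hχ1 (le_max_right μ 0)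
    (max_lt hμ (by linarith)) hθ hb hf hl hl0 hC hbC' hlC hu hU hsub hc hfγ
  set g : (Fin n → ℝ) → ℝ := fun x => max (u x - γ) 0 * (‖U x‖ ^ 2 / √(1 + ‖U x‖ ^ 2)) with hg
  have hg0 : ∀ x, 0 ≤ g x := fun x => mul_nonneg (le_max_right _ _) (by positivity)
  have hae : ∀ k : ℕ, ∀ᵐ x, x ∈ Metric.closedBall (0 : Fin n → ℝ) k → g x = 0 := by
    intro k
    have hm : MeasurableSet (Metric.closedBall (0 : Fin n → ℝ) k) :=
      Metric.isClosed_closedBall.measurableSet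
    -- The integral over a fixed ball is dominated by that over any larger one, hence by C'/R with R
    -- → ∞.
    have hmono : ∀ R : ℝ, max 1 (k : ℝ) ≤ R → ∫ x in Metric.closedBall 0 (k : ℝ), g x ≤ C' / R :=
      fun R hR => le_trans (setIntegral_mono_set (hE R ((le_max_left _ _).trans hR)).1
        (Eventually.of_forall hg0)
        (Metric.closedBall_subset_closedBall ((le_max_right _ _).trans hR)).eventuallyLE)
        (hE R ((le_max_left _ _).trans hR)).2
    have hle : ∫ x in Metric.closedBall 0 (k : ℝ), g x ≤ 0 :=
      ge_of_tendsto (tendsto_const_nhds.div_atTop tendsto_id) (eventually_atTop.2 ⟨_, hmono⟩)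
    have hint : IntegrableOn g (Metric.closedBall 0 (k : ℝ)) :=
      (hE (max 1 k) (le_max_left _ _)).1.mono_set
        (Metric.closedBall_subset_closedBall (le_max_right _ _))
    have h0 := (setIntegral_eq_zero_iff_of_nonneg_ae (Eventually.of_forall hg0) hint).1
      (le_antisymm hle (setIntegral_nonneg hm fun x _ => hg0 x))
    exact (ae_restrict_iff' hm).1 h0
  have hgae : ∀ᵐ x, g x = 0 := by
    filter_upwards [ae_all_iff.2 hae] with x hx
    obtain ⟨k, hk⟩ := exists_nat_ge ‖x‖
    exact hx k (mem_closedBall_zero_iff.2 hk)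
  have hV := hU.comp hr hu (F := fun a => max (a - γ) 0 ^ 2) (F' := fun a => 2 * max (a - γ) 0)
    (by fun_prop) (by fun_prop) (truncSq_sub_le γ)
  have hV0 : ∀ᵐ x, (2 * max (u x - γ) 0) • U x = 0 := by
    filter_upwards [hgae] with x hx
    rcases mul_eq_zero.1 hx with h | h
    · simp [h]
    · have hq : √(1 + ‖U x‖ ^ 2) ≠ 0 := (Real.sqrt_pos.2 (by positivity)).ne'
      have : U x = 0 := by simpa [hq] using h
      simp [this]
  have hconst := eq_of_weak_derivative_eq_zero hr (w := fun x => max (u x - γ) 0 ^ 2)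
    (by fun_prop) fun j φ hφ hφc => by
      rw [hV.2 j φ hφ hφc, integral_eq_zero_of_ae, neg_zero]
      filter_upwards [hV0] with x hx
      simp only [hx]
      simp
  have hconst' : ∀ x, max (u x - γ) 0 = max (u 0 - γ) 0 := fun x =>
    (pow_left_inj₀ (le_max_right _ _) (le_max_right _ _) two_ne_zero).1 (hconst x)
  rcases le_or_gt (u 0) γ with h | h
  · left
    intro x
    have := hconst' x
    rw [max_eq_right (by linarith : u 0 - γ ≤ 0)] at this
    linarith [le_max_left (u x - γ) 0]
  -- Here the constant value of the truncation is positive, so the truncation is nowhere active and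
  -- u itself is constant.
  · right
    refine ⟨u 0, fun x => ?_⟩
    have h1 := hconst' x
    rw [max_eq_left (by linarith : 0 ≤ u 0 - γ)] at h1
    rcases max_choice (u x - γ) 0 with h2 | h2 <;> linarith

lemma IsMeanCurvatureSubsolution.bddAbove_and_le (hr : G.IsHomogeneousNorm r)
    {μ χ θ : ℝ} (hχ0 : 0 ≤ χ) (hχ1 : χ ≤ 1) (hμ : μ < 2 - χ) (hθ : 1 - χ < θ)
    {b : (Fin n → ℝ) → ℝ} (hb : Continuous b) {f l : ℝ → ℝ} (hf : Continuous f)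
    (hl : ContinuousOn l (Ici 0)) (hlpos : ∀ t, 0 < t → 0 < l t) {C : ℝ} (hC : 0 < C)
    (hbC : ∀ x, C * (1 + r x) ^ (-μ) ≤ b x) (hlC : ∀ t, 0 < t → C * (t ^ χ / (1 + t)) ≤ l t)
    {c : ℝ} (hc : 0 < c) {T : ℝ} (hfT : ∀ t, T ≤ t → c * t ^ θ ≤ f t)
    {u : (Fin n → ℝ) → ℝ} (hu : G.IsMeanCurvatureSubsolution r b f l u) :
    BddAbove (range u) ∧ ((¬ ∃ c, ∀ x, u x = c) → f (⨆ x, u x) ≤ 0) := by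
  have hθ0 : 0 < θ := by linarith
  have key : ∀ {γ c : ℝ}, 0 < c → (∀ x, γ < u x → c * (1 + (u x - γ)) ^ θ ≤ f (u x)) →
      (∀ x, u x ≤ γ) ∨ ∃ c, ∀ x, u x = c := fun hc h =>
    hu.le_or_const hr hχ0 hχ1 hμ hθ hb hf hl hlpos hC hbC hlC hc h
  have hbdd : BddAbove (range u) := by
    -- Since γ ≥ 1, 1 + (u - γ) ≤ u, so the growth of f beyond T gives the required form.
    rcases key (γ := max T 1) hc fun x hx => by
      have h1 := (le_max_left T 1).trans hx.le
      have h2 := (le_max_right T 1).trans hx.le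
      have h3 := le_max_right T 1
      refine le_trans (mul_le_mul_of_nonneg_left ?_ hc.le) (hfT _ h1)
      exact Real.rpow_le_rpow (by linarith) (by linarith) hθ0.le with h | ⟨a, h⟩
    · exact ⟨_, forall_mem_range.2 h⟩
    · exact ⟨a, forall_mem_range.2 fun x => (h x).le⟩
  refine ⟨hbdd, fun hnc => ?_⟩
  by_contra! hpos
  set S := ⨆ x, u x
  have hev : ∀ᶠ t in 𝓝 S, f S / 2 < f t :=
    (hf.tendsto S).eventually (lt_mem_nhds (by linarith))
  obtain ⟨δ, hδ, hball⟩ := Metric.eventually_nhds_iff.1 hev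
  have hle : ∀ x, u x ≤ S := fun x => le_ciSup hbdd x
  -- On {u > γ} the factor (1 + u - γ)^θ is at most (1 + δ/2)^θ, so dividing by it turns the
  -- constant bound f S / 2 into a growth bound.
  rcases key (γ := S - δ / 2) (c := f S / 2 / (1 + δ / 2) ^ θ) (by positivity) fun x hx => by
    have h1 : f S / 2 < f (u x) := hball (by
      rw [Real.dist_eq, abs_lt]; constructor <;> linarith [hle x])
    refine le_trans ?_ h1.le
    rw [div_mul_eq_mul_div, div_le_iff₀ (by positivity)]
    refine mul_le_mul_of_nonneg_left ?_ (by linarith)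
    exact Real.rpow_le_rpow (by linarith) (by linarith [hle x]) hθ0.le with h | h
  · have : S ≤ S - δ / 2 := ciSup_le h
    linarith
  · exact hnc h

lemma IsMeanCurvatureSolution.isMeanCurvatureSubsolution {b : (Fin n → ℝ) → ℝ} {f l : ℝ → ℝ}
    {u : (Fin n → ℝ) → ℝ} (hu : G.IsMeanCurvatureSolution r b f l u) :
    G.IsMeanCurvatureSubsolution r b f l u := by
  obtain ⟨hL, U, hU, h⟩ := hu
  exact ⟨hL, U, hU, fun φ Φ h1 h2 h3 => (h φ Φ h1 h2 h3).le⟩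

/-- The operator is odd in u and the source depends on the gradient only through its norm; equality
survives the change of sign. -/
lemma IsMeanCurvatureSolution.neg (hr : G.IsHomogeneousNorm r) {b : (Fin n → ℝ) → ℝ} {f l : ℝ → ℝ}
    {u : (Fin n → ℝ) → ℝ} (hu : G.IsMeanCurvatureSolution r b f l u) :
    G.IsMeanCurvatureSolution r b (fun t => -f (-t)) l fun x => -u x := by
  obtain ⟨hL, U, hU, h⟩ := hu
  refine ⟨fun x => ?_, fun x => -U x, ⟨hU.1.neg, fun j φ hφ hc => ?_⟩, fun φ Φ h1 h2 h3 => ?_⟩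
  · obtain ⟨S, hS, C, hC, hlip⟩ := hL x
    refine ⟨S, hS, C, hC, fun y hy z hz => ?_⟩
    have := hlip z hz y hy
    rw [← hr.symm, G.inv_mul_rev, G.inv_inv] at this
    linarith
  · have := hU.2 j φ hφ hc
    simp only [neg_mul, PiLp.neg_apply, integral_neg]
    linarith
  · have := h φ Φ h1 h2 h3
    simp only [inner_neg_left, norm_neg, neg_neg, neg_div, mul_neg, neg_mul, integral_neg]
    linarith

end HomogeneousCarnotGroup

end

theorem mainTheorem5 {n : ℕ} (G : HomogeneousCarnotGroup n)
    (r : (Fin n → ℝ) → ℝ) (hr : G.IsHomogeneousNorm r)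
    (μ χ ω : ℝ) (hχ0 : 0 ≤ χ) (hχ1 : χ ≤ 1) (hμ : μ < 2 - χ) (hω : 1 - χ < ω)
    (b : (Fin n → ℝ) → ℝ) (hb : Continuous b) (hbpos : ∀ x, 0 < b x)
    (f : ℝ → ℝ) (hf : Continuous f)
    (l : ℝ → ℝ) (hl : ContinuousOn l (Ici 0)) (hlpos : ∀ t, 0 < t → 0 < l t)
    (C : ℝ) (hC : 0 < C)
    (hbC : ∀ x, C * (1 + r x) ^ (-μ) ≤ b x)
    (hfC : ∃ T : ℝ, ∀ t, T ≤ t → C * t ^ ω ≤ f t)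
    (hlC : ∀ t, 0 < t → C * (t ^ χ / (1 + t)) ≤ l t) :
    (∀ u : (Fin n → ℝ) → ℝ, G.IsMeanCurvatureSubsolution r b f l u →
      BddAbove (range u) ∧ ((¬ ∃ c, ∀ x, u x = c) → f (⨆ x, u x) ≤ 0)) ∧
    ((∃ C' : ℝ, 0 < C' ∧ ∃ T : ℝ, ∀ t, T ≤ |t| → C' * |t| ^ (ω + 1) ≤ t * f t) →
      ∀ u : (Fin n → ℝ) → ℝ, G.IsMeanCurvatureSolution r b f l u →
        BddAbove (range u) ∧ BddBelow (range u) ∧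
        ((¬ ∃ c, ∀ x, u x = c) → f (⨆ x, u x) ≤ 0 ∧ 0 ≤ f (⨅ x, u x))) := by
  obtain ⟨T, hfT⟩ := hfC
  have hsub : ∀ u : (Fin n → ℝ) → ℝ, G.IsMeanCurvatureSubsolution r b f l u →
      BddAbove (range u) ∧ ((¬ ∃ c, ∀ x, u x = c) → f (⨆ x, u x) ≤ 0) := fun u hu =>
    hu.bddAbove_and_le hr hχ0 hχ1 hμ hω hb hf hl hlpos hC hbC hlC hC hfT
  refine ⟨hsub, ?_⟩
  rintro ⟨C', hC', T', hT'⟩ u hu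
  obtain ⟨h1, h2⟩ := hsub u hu.isMeanCurvatureSubsolution
  -- Taking T at least 1 makes t positive, so the two-sided growth condition at -t can be divided by
  -- t.
  obtain ⟨h3, h4⟩ := (hu.neg hr).isMeanCurvatureSubsolution.bddAbove_and_le hr hχ0 hχ1 hμ hω hb
    (f := fun t => -f (-t)) (by fun_prop) hl hlpos hC hbC hlC hC' (T := max T' 1) fun t ht => by
      have ht0 : 0 < t := by linarith [(le_max_right T' 1).trans ht]
      have := hT' (-t) (by rw [abs_neg, abs_of_pos ht0]; exact (le_max_left _ _).trans ht)
      rw [abs_neg, abs_of_pos ht0, Real.rpow_add ht0, Real.rpow_one] at this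
      refine le_of_mul_le_mul_left ?_ ht0
      linarith
  have hrange : range (fun x => -u x) = -range u := by
    ext y
    simp [neg_eq_iff_eq_neg]
  rw [hrange, bddAbove_neg] at h3
  refine ⟨h1, h3, fun hnc => ⟨h2 hnc, ?_⟩⟩
  have h5 := h4 fun ⟨c, hc⟩ => hnc ⟨-c, fun x => by rw [← hc x, neg_neg]⟩
  have hsup : ⨆ x, -u x = -⨅ x, u x := by
    rw [iSup, hrange, Real.sSup_neg, iInf]
  rw [hsup, neg_neg] at h5
  linarith
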